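/- Let $d\ge 1$ and let $\Omega\subset\mathbb{R}^d$ be a bounded open set. Let $a$ be a measurable symmetric $d\times d$ matrix-valued function on $\Omega$ and let $\lambda_{\max}(a)\ge\lambda_{\min}(a)>0$ be such that $\lambda_{\min}(a)|\xi|^2\le \xi^T a(x)\xi\le\lambda_{\max}(a)|\xi|^2$ for all $\xi\in\mathbb{R}^d$ and almost every $x\in\Omega$. Write $\|\psi\|_a^2:=\int_\Omega(\nabla\psi)^Ta\nabla\psi$ for $\psi\in H^1_0(\Omega)$, where $H^1_0(\Omega)$ is the closure of $C_c^\infty(\Omega)$ in $H^1(\Omega)$. Let $H>0$, $\delta\in(0,1)$, and let $(\tau_j)_{1\le j\le m}$ be a partition of $\Omega$ (up to sets of measure zero) into convex subsets of diameter at most $H$, each containing a ball of diameter $\delta H$. Let $\phi_j$ be the function equal to one on $\tau_j$ and zero elsewhere. For $i\in\{1,\dots,m\}$ let the gamblet $\psi_i$ be the minimizer of $\|\psi\|_a$ over all $\psi\in H^1_0(\Omega)$ with $\int_\Omega\phi_j\psi=\delta_{i,j}$ for $j=1,\dots,m$ (where $\delta_{i,j}$ is the Kronecker delta), and let $x_i\in\tau_i$.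 Then, for all $r\ge 0$, $$\int_{\Omega\cap (B(x_i,r))^c}(\nabla\psi_i)^Ta\nabla\psi_i\le e^{1-\frac{r}{lH}}\int_\Omega(\nabla\psi_i)^Ta\nabla\psi_i ,$$ where $B(x_i,r)$ is the ball of center $x_i$ and radius $r$ and $$l=1+\frac{e}{\pi}\sqrt{\frac{\lambda_{\max}(a)}{\lambda_{\min}(a)}}\,\Bigl(1+2^{3/2}\,(2/\delta)^{1+d/2}\Bigr).$$ -/

import Mathlib

open MeasureTheory Set Filter Topology
open scoped ContDiff Matrix

noncomputable section

/-- Smooth functions with compact support inside `Ω`. -/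
def IsTestFunction {d : ℕ} (Ω : Set (EuclideanSpace ℝ (Fin d)))
    (φ : EuclideanSpace ℝ (Fin d) → ℝ) : Prop :=
  ContDiff ℝ ∞ φ ∧ HasCompactSupport φ ∧ tsupport φ ⊆ Ω

/-- An element of the Sobolev space `H¹₀(Ω)`, the closure of the test functions in the `H¹` norm,
given by a representative together with its (weak) gradient: both are limits in `L²(Ω)` along one
and the same sequence of test functions, so `grad` is determined by `toFun` almost everywhere
in `Ω`. Only the values on `Ω` matter. -/
structure H10 {d : ℕ} (Ω : Set (EuclideanSpace ℝ (Fin d))) where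
  toFun : EuclideanSpace ℝ (Fin d) → ℝ
  grad : EuclideanSpace ℝ (Fin d) → EuclideanSpace ℝ (Fin d)
  memLp_toFun : MemLp toFun 2 (volume.restrict Ω)
  memLp_grad : MemLp grad 2 (volume.restrict Ω)
  exists_approx : ∃ φ : ℕ → EuclideanSpace ℝ (Fin d) → ℝ,
    (∀ n, IsTestFunction Ω (φ n)) ∧
    Tendsto (fun n => eLpNorm (fun x => φ n x - toFun x) 2 (volume.restrict Ω)) atTop (𝓝 0) ∧
    Tendsto (fun n => eLpNorm (fun x => gradient (φ n) x - grad x) 2 (volume.restrict Ω))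
      atTop (𝓝 0)

/-- `a` is a measurable, symmetric coefficient matrix on `Ω` with
`lmin |ξ|² ≤ ξᵀ a(x) ξ ≤ lmax |ξ|²` and `lmin > 0`. -/
structure IsUniformlyElliptic {d : ℕ} (Ω : Set (EuclideanSpace ℝ (Fin d)))
    (a : EuclideanSpace ℝ (Fin d) → Matrix (Fin d) (Fin d) ℝ) (lmin lmax : ℝ) : Prop where
  aemeasurable : ∀ p q, AEMeasurable (fun x => a x p q) (volume.restrict Ω)
  symm : ∀ᵐ x ∂(volume.restrict Ω), (a x).IsSymm
  lmin_pos : 0 < lmin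
  lower : ∀ᵐ x ∂(volume.restrict Ω), ∀ ξ : EuclideanSpace ℝ (Fin d),
    lmin * ‖ξ‖ ^ 2 ≤ ⇑ξ ⬝ᵥ (a x *ᵥ ⇑ξ)
  upper : ∀ᵐ x ∂(volume.restrict Ω), ∀ ξ : EuclideanSpace ℝ (Fin d),
    ⇑ξ ⬝ᵥ (a x *ᵥ ⇑ξ) ≤ lmax * ‖ξ‖ ^ 2

/-- The energy `∫_S (∇ψ)ᵀ a ∇ψ` of `ψ ∈ H¹₀(Ω)` in a set `S`. -/
def energyOn {d : ℕ} {Ω : Set (EuclideanSpace ℝ (Fin d))}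
    (a : EuclideanSpace ℝ (Fin d) → Matrix (Fin d) (Fin d) ℝ)
    (S : Set (EuclideanSpace ℝ (Fin d))) (ψ : H10 Ω) : ℝ :=
  ∫ x in S, ⇑(ψ.grad x) ⬝ᵥ (a x *ᵥ ⇑(ψ.grad x))

/-- The energy norm `‖ψ‖_a` on `H¹₀(Ω)`. -/
def energyNorm {d : ℕ} {Ω : Set (EuclideanSpace ℝ (Fin d))}
    (a : EuclideanSpace ℝ (Fin d) → Matrix (Fin d) (Fin d) ℝ) (ψ : H10 Ω) : ℝ :=
  Real.sqrt (energyOn a Ω ψ)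

/-- A partition of `Ω` (up to null sets) into convex cells of diameter at most `H`, each of which
contains a ball of diameter `δ H`. A bounded convex set with interior points is Lipschitz. -/
structure IsCellPartition {d m : ℕ} (Ω : Set (EuclideanSpace ℝ (Fin d)))
    (τ : Fin m → Set (EuclideanSpace ℝ (Fin d))) (H δ : ℝ) : Prop where
  subset : ∀ j, τ j ⊆ Ω
  disjoint : Pairwise (fun j k => AEDisjoint volume (τ j) (τ k))
  cover : volume (Ω \ ⋃ j, τ j) = 0
  convex : ∀ j, Convex ℝ (τ j)
  diam_le : ∀ j, Metric.diam (τ j) ≤ H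
  exists_ball : ∀ j, ∃ c, Metric.ball c (δ * H / 2) ⊆ τ j

/-- The measurement function `φ_j`: one on the `j`-th cell and zero elsewhere. -/
def measurementFun {d m : ℕ} (τ : Fin m → Set (EuclideanSpace ℝ (Fin d))) (j : Fin m) :
    EuclideanSpace ℝ (Fin d) → ℝ :=
  (τ j).indicator (fun _ => 1)

/-- The constraints `∫_Ω φ_j ψ = δ_{i,j}` for all `j`. -/
def SatisfiesConstraints {d m : ℕ} {Ω : Set (EuclideanSpace ℝ (Fin d))}
    (φ : Fin m → EuclideanSpace ℝ (Fin d) → ℝ) (i : Fin m) (ψ : H10 Ω) : Prop :=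
  ∀ j, ∫ x in Ω, φ j x * ψ.toFun x = if i = j then 1 else 0

/-- `ψ` is the `i`-th gamblet for the measurement functions `φ`: it minimizes the energy norm over
all elements of `H¹₀(Ω)` that satisfy the constraints. -/
def IsGamblet {d m : ℕ} {Ω : Set (EuclideanSpace ℝ (Fin d))}
    (a : EuclideanSpace ℝ (Fin d) → Matrix (Fin d) (Fin d) ℝ)
    (φ : Fin m → EuclideanSpace ℝ (Fin d) → ℝ) (i : Fin m) (ψ : H10 Ω) : Prop :=
  SatisfiesConstraints φ i ψ ∧
    ∀ χ : H10 Ω, SatisfiesConstraints φ i χ → energyNorm a ψ ≤ energyNorm a χ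

/-- `l = 1 + (e/π) √(λ_max/λ_min) (1 + 2^{3/2} (2/δ)^{1+d/2})`. -/
def decayLength (d : ℕ) (lmin lmax δ : ℝ) : ℝ :=
  1 + (Real.exp 1 / Real.pi) * Real.sqrt (lmax / lmin) *
    (1 + (2 : ℝ) ^ (3 / 2 : ℝ) * (2 / δ) ^ (1 + (d : ℝ) / 2))

end

/-! The decay is a discrete hole-filling (Caccioppoli) argument. Minimality makes `ψ`
energy-orthogonal to every `w` with zero mean on all cells (`IsGamblet.integral_matForm_eq_zero`),
so for arbitrary `v` the pairing `∫ ∇vᵀ a ∇ψ` equals `∑ l_j ∫_{τ_j} v` with multipliers `l_j`.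
Testing against a bump supported in one cell bounds `l_j` by the energy `E_j` of `ψ` in that cell
alone (`exists_multiplier`). The bump is the truncated gauge of the cell, which has slope at most
`2/(δH)` and average close to `1/(d+1)`.

Now take `v = ηψ`, with `η` a cutoff that vanishes on the cell of `x` and has Lipschitz constant
`1/w`. Cells with `η = 0` contribute nothing. Cells with `η = 1` contribute exactly `E_j`, since the
mean of `ψ` there is zero. On a cell of the transition shell, the product rule leaves `ψ∇η`, and the
multiplier term sees only the oscillation of `η`; by Poincaré both are at most a multiple of `E_j`.
Hence the energy outside the shell is at most `(H/w) K` times the energy in the shell, with `K =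
shellConst` (`sum_energyOn_le`).

Let `g(R)` be the energy of the cells not contained in `B(x, R)`. Then `g(R+w+H) ≤ (H/w) K (g(R) -
g(R+w+H))` for `R ≥ H`. With `w = (l-2)H`, the numerical inequality `K(e-1) ≤ l-2`
(`shellConst_mul_le`) turns this into `e · g(R+(l-1)H) ≤ g(R)`, which is iterated from `R = H`.

The Poincaré constant used is `√2 · H · ∫_{1/2}^1 t^(-d/2) dt` instead of the sharp `H/π`. The loss
is affordable because the multiplier bound grows only like `(d+1)/δ`, whereas `l` contains
`(2/δ)^(1+d/2)`. -/

open scoped NNReal ENNReal Convolution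

noncomputable section

/-! ### Compactly supported Lipschitz functions belong to `H¹₀`. -/

section Mollification

variable {d : ℕ}

local notation "E" => EuclideanSpace ℝ (Fin d)

theorem LipschitzWith.norm_gradient_le {f : E → ℝ} {C : ℝ≥0} (hf : LipschitzWith C f) (x : E) :
    ‖gradient f x‖ ≤ C := by
  simpa [gradient] using norm_fderiv_le_of_lipschitz ℝ hf (x₀ := x)

theorem measurable_gradient (f : E → ℝ) : Measurable (gradient f) :=
  (InnerProductSpace.toDual ℝ E).symm.continuous.measurable.comp (measurable_fderiv ℝ f)

theorem LipschitzWith.locallyIntegrable_gradient {f : E → ℝ} {C : ℝ≥0} (hf : LipschitzWith C f) :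
    LocallyIntegrable (gradient f) volume := by
  refine (locallyIntegrable_const (C : ℝ)).mono (measurable_gradient f).aestronglyMeasurable ?_
  exact Eventually.of_forall fun x => (hf.norm_gradient_le x).trans (le_abs_self _)

theorem tsupport_gradient_subset (f : E → ℝ) : tsupport (gradient f) ⊆ tsupport f := by
  refine closure_minimal ?_ isClosed_closure
  intro x hx
  refine tsupport_fderiv_subset ℝ (f := f) (subset_tsupport _ ?_)
  intro h
  exact hx (by simp [gradient, h])

/-- Differentiation under the integral sign, falling on `f`: Rademacher gives the derivative for
almost every shift, and `C|ρ|` dominates the difference quotients. Since the gradient of a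
mollification is thus the mollified gradient, one convergence statement serves both for `f` and for
its gradient. -/
theorem LipschitzWith.hasGradientAt_convolution {f ρ : E → ℝ} {C : ℝ≥0} (hf : LipschitzWith C f)
    (hρ : Continuous ρ) (hρc : HasCompactSupport ρ) (x : E) :
    HasGradientAt (ρ ⋆[ContinuousLinearMap.lsmul ℝ ℝ, volume] f)
      ((ρ ⋆[ContinuousLinearMap.lsmul ℝ ℝ, volume] gradient f) x) x := by
  have hρi : Integrable ρ volume := hρ.integrable_of_hasCompactSupport hρc
  have hd : ∀ᵐ t : E ∂volume, DifferentiableAt ℝ f (x - t) :=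
    (quasiMeasurePreserving_sub_left volume x).ae hf.ae_differentiableAt
  have key := hasFDerivAt_integral_of_dominated_loc_of_lip (𝕜 := ℝ) (μ := (volume : Measure E))
    (F := fun x t => ρ t • f (x - t)) (F' := fun t => ρ t • fderiv ℝ f (x - t)) (x₀ := x)
    (bound := fun t => C * ρ t) (s := univ) univ_mem ?_ ?_ ?_ ?_ (hρi.const_mul _) ?_
  · rw [hasGradientAt_iff_hasFDerivAt]
    have h : InnerProductSpace.toDual ℝ E
        ((ρ ⋆[ContinuousLinearMap.lsmul ℝ ℝ, volume] gradient f) x)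
        = ∫ t, ρ t • fderiv ℝ f (x - t) := by
      rw [convolution_def]
      have h2 := ((InnerProductSpace.toDual ℝ E).toContinuousLinearEquiv.integral_comp_comm
        (μ := volume) (fun t => ρ t • gradient f (x - t))).symm
      refine h2.trans (integral_congr_ae (Eventually.of_forall fun t => ?_))
      simp [gradient]
    rw [h]
    exact key.2
  · exact Eventually.of_forall fun y =>
      (hρ.smul (hf.continuous.comp (continuous_const.sub continuous_id))).aestronglyMeasurable
  · exact (hρ.smul (hf.continuous.comp
      (continuous_const.sub continuous_id))).integrable_of_hasCompactSupport hρc.smul_right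
  · exact hρ.aestronglyMeasurable.smul
      ((measurable_fderiv ℝ f).comp (measurable_const.sub measurable_id)).aestronglyMeasurable
  · refine Eventually.of_forall fun t => LipschitzOnWith.of_dist_le_mul fun y _ z _ => ?_
    have h := hf.dist_le_mul (y - t) (z - t)
    rw [dist_sub_right] at h
    simp only [smul_eq_mul, Real.dist_eq, ← mul_sub, abs_mul, Real.coe_nnabs, NNReal.abs_eq] at h ⊢
    nlinarith [abs_nonneg (ρ t)]
  · filter_upwards [hd] with t ht
    have h1 : HasFDerivAt (fun y => f (y - t)) (fderiv ℝ f (x - t)) x := by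
      exact ht.hasFDerivAt.comp x ((hasFDerivAt_id x).sub_const t)
    exact h1.const_smul (ρ t)

/-- The standard sequence of bump functions concentrating at the origin inside a ball. -/
def shrinkingBump (d : ℕ) (ε : ℝ) (hε : 0 < ε) (n : ℕ) : ContDiffBump (0 : EuclideanSpace ℝ (Fin d)) where
  rIn := ε / 2 / (n + 1)
  rOut := ε / (n + 1)
  rIn_pos := by positivity
  rIn_lt_rOut := by gcongr; linarith

theorem norm_convolution_normed_le {F : Type*} [NormedAddCommGroup F] [NormedSpace ℝ F]
    (φ : ContDiffBump (0 : E)) {g : E → F} {C : ℝ} (hg : ∀ x, ‖g x‖ ≤ C) (x : E) :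
    ‖(φ.normed volume ⋆[ContinuousLinearMap.lsmul ℝ ℝ, volume] g) x‖ ≤ C := by
  rw [convolution_def]
  calc _ ≤ ∫ t, φ.normed volume t * C := by
        refine norm_integral_le_of_norm_le (φ.integrable_normed.mul_const C) ?_
        refine Eventually.of_forall fun t => ?_
        rw [ContinuousLinearMap.lsmul_apply, norm_smul, Real.norm_of_nonneg (φ.nonneg_normed t)]
        exact mul_le_mul_of_nonneg_left (hg _) (φ.nonneg_normed t)
    _ = C := by rw [integral_mul_const, φ.integral_normed, one_mul]

/-- Mollifications converge almost everywhere by Lebesgue differentiation. They inherit the bound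
`C`, hence are uniformly integrable on the bounded set, and Vitali's theorem upgrades the
convergence to `L²`. -/
theorem tendsto_eLpNorm_convolution_normed {F : Type*} [NormedAddCommGroup F] [NormedSpace ℝ F]
    [CompleteSpace F] {Ω : Set E} (hΩ : Bornology.IsBounded Ω) {ε : ℝ} (hε : 0 < ε)
    {g : E → F} {C : ℝ} (hgm : LocallyIntegrable g volume) (hg : ∀ x, ‖g x‖ ≤ C) :
    Tendsto (fun n => eLpNorm (fun x =>
      ((shrinkingBump d ε hε n).normed volume ⋆[ContinuousLinearMap.lsmul ℝ ℝ, volume] g) x - g x) 2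
        (volume.restrict Ω)) atTop (𝓝 0) := by
  have hfin : IsFiniteMeasure (volume.restrict Ω) := ⟨by simpa using hΩ.measure_lt_top⟩
  have hlim := ContDiffBump.ae_convolution_tendsto_right_of_locallyIntegrable (μ := volume)
    (φ := shrinkingBump d ε hε) (l := atTop) (K := 2) (g := g)
    (by
      have := (tendsto_const_div_atTop_nhds_zero_nat ε).comp (tendsto_add_atTop_nat 1)
      refine this.congr fun n => ?_
      simp [shrinkingBump])
    (Eventually.of_forall fun n => by simp only [shrinkingBump]; apply le_of_eq; field_simp) hgm
  have hmeas : ∀ n, AEStronglyMeasurable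
      ((shrinkingBump d ε hε n).normed volume ⋆[ContinuousLinearMap.lsmul ℝ ℝ, volume] g)
        (volume.restrict Ω) := fun n =>
    (HasCompactSupport.continuous_convolution_left (ContinuousLinearMap.lsmul ℝ ℝ)
      (shrinkingBump d ε hε n).hasCompactSupport_normed
      (shrinkingBump d ε hε n).continuous_normed hgm).aestronglyMeasurable
  refine tendsto_Lp_finite_of_tendsto_ae (by norm_num) (by norm_num) hmeas ?_ ?_
    (ae_restrict_of_ae hlim)
  · exact MemLp.of_bound hgm.aestronglyMeasurable.restrict C (Eventually.of_forall hg)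
  -- The threshold `C + 1` exceeds the uniform bound, so the sets of large values are empty.
  · refine unifIntegrable_of one_le_two (by norm_num) hmeas fun η _ => ⟨C.toNNReal + 1, fun n => ?_⟩
    have : {x | C.toNNReal + 1 ≤ ‖((shrinkingBump d ε hε n).normed volume
        ⋆[ContinuousLinearMap.lsmul ℝ ℝ, volume] g) x‖₊} = ∅ := by
      refine eq_empty_of_forall_notMem fun x hx => ?_
      have h1 : (C.toNNReal + 1 : ℝ) ≤ _ := NNReal.coe_le_coe.2 hx
      have h2 := norm_convolution_normed_le (shrinkingBump d ε hε n) hg x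
      rw [coe_nnnorm] at h1
      linarith [Real.le_coe_toNNReal C]
    simp [this]

theorem LipschitzWith.exists_testFunction_tendsto {Ω : Set E} (hΩo : IsOpen Ω)
    (hΩ : Bornology.IsBounded Ω) {f : E → ℝ} {C : ℝ≥0} (hf : LipschitzWith C f)
    (hfc : HasCompactSupport f) (hfs : tsupport f ⊆ Ω) :
    ∃ φ : ℕ → E → ℝ, (∀ n, IsTestFunction Ω (φ n)) ∧
      Tendsto (fun n => eLpNorm (fun x => φ n x - f x) 2 (volume.restrict Ω)) atTop (𝓝 0) ∧
      Tendsto (fun n => eLpNorm (fun x => gradient (φ n) x - gradient f x) 2 (volume.restrict Ω))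
        atTop (𝓝 0) := by
  obtain ⟨ε, hε, hεΩ⟩ := IsCompact.exists_cthickening_subset_open hfc hΩo hfs
  obtain ⟨M, hM⟩ := hf.continuous.bounded_above_of_compact_support hfc
  refine ⟨fun n => (shrinkingBump d ε hε n).normed volume
    ⋆[ContinuousLinearMap.lsmul ℝ ℝ, volume] f, fun n => ⟨?_, ?_, ?_⟩, ?_, ?_⟩
  · exact HasCompactSupport.contDiff_convolution_left _
      (shrinkingBump d ε hε n).hasCompactSupport_normed
      (shrinkingBump d ε hε n).contDiff_normed hf.continuous.locallyIntegrable
  · exact HasCompactSupport.convolution _ (shrinkingBump d ε hε n).hasCompactSupport_normed hfc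
  · refine Subset.trans ?_ hεΩ
    refine closure_minimal ?_ Metric.isClosed_cthickening
    refine (support_convolution_subset _).trans ?_
    rintro _ ⟨y, hy, z, hz, rfl⟩
    rw [ContDiffBump.support_normed_eq] at hy
    refine Metric.mem_cthickening_of_dist_le _ z _ _ (subset_tsupport _ hz) ?_
    have h1 : ε / ((n : ℝ) + 1) ≤ ε := div_le_self hε.le (by linarith [n.cast_nonneg (α := ℝ)])
    simp only [shrinkingBump, Metric.mem_ball, dist_zero_right] at hy
    simpa using hy.le.trans h1
  · exact tendsto_eLpNorm_convolution_normed hΩ hε hf.continuous.locallyIntegrable hM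
  · refine (tendsto_eLpNorm_convolution_normed hΩ hε hf.locallyIntegrable_gradient
      hf.norm_gradient_le).congr fun n => ?_
    congr 1
    ext1 x
    rw [(hf.hasGradientAt_convolution (shrinkingBump d ε hε n).continuous_normed
      (shrinkingBump d ε hε n).hasCompactSupport_normed x).gradient]

/-- A Lipschitz function with compact support in `Ω`, as an element of `H¹₀(Ω)`. -/
def H10.ofLipschitz {Ω : Set E} (hΩo : IsOpen Ω) (hΩ : Bornology.IsBounded Ω) {f : E → ℝ} {C : ℝ≥0}
    (hf : LipschitzWith C f) (hfc : HasCompactSupport f) (hfs : tsupport f ⊆ Ω) : H10 Ω where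
  toFun := f
  grad := gradient f
  memLp_toFun := (hf.continuous.memLp_of_hasCompactSupport hfc).restrict Ω
  memLp_grad := by
    have hfin : IsFiniteMeasure (volume.restrict Ω) := ⟨by simpa using hΩ.measure_lt_top⟩
    exact MemLp.of_bound (measurable_gradient f).aestronglyMeasurable C
      (Eventually.of_forall hf.norm_gradient_le)
  exists_approx := hf.exists_testFunction_tendsto hΩo hΩ hfc hfs

end Mollification

/-! ### Closedness and linear combinations in `H¹₀`. -/

section Algebra

variable {d : ℕ} {Ω : Set (EuclideanSpace ℝ (Fin d))}

local notation "E" => EuclideanSpace ℝ (Fin d)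

/-- `H¹₀(Ω)` is closed under convergence in `H¹`. -/
theorem H10.exists_of_tendsto {f : E → ℝ} {G : E → E} (hf : MemLp f 2 (volume.restrict Ω))
    (hG : MemLp G 2 (volume.restrict Ω)) (u : ℕ → H10 Ω)
    (hu : Tendsto (fun n => eLpNorm (fun x => (u n).toFun x - f x) 2 (volume.restrict Ω)) atTop
      (𝓝 0))
    (hu' : Tendsto (fun n => eLpNorm (fun x => (u n).grad x - G x) 2 (volume.restrict Ω)) atTop
      (𝓝 0)) : ∃ w : H10 Ω, w.toFun = f ∧ w.grad = G := by
  -- Diagonal choice: a test function within `1/(n+1)` of `u n`, for values and gradients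
  -- simultaneously.
  have key : ∀ n : ℕ, ∃ φ : E → ℝ, IsTestFunction Ω φ ∧
      eLpNorm (fun x => φ x - (u n).toFun x) 2 (volume.restrict Ω) ≤ (n + 1 : ℝ≥0∞)⁻¹ ∧
      eLpNorm (fun x => gradient φ x - (u n).grad x) 2 (volume.restrict Ω) ≤ (n + 1 : ℝ≥0∞)⁻¹ := by
    intro n
    obtain ⟨φ, h1, h2, h3⟩ := (u n).exists_approx
    have hpos : (0 : ℝ≥0∞) < (n + 1 : ℝ≥0∞)⁻¹ := by simp
    obtain ⟨k, hk, hk'⟩ := ((h2.eventually_le_const hpos).and (h3.eventually_le_const hpos)).exists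
    exact ⟨φ k, h1 k, hk, hk'⟩
  choose φ h1 h2 h3 using key
  have hz : Tendsto (fun n : ℕ => (n + 1 : ℝ≥0∞)⁻¹) atTop (𝓝 0) := by
    have := ENNReal.tendsto_inv_nat_nhds_zero.comp (tendsto_add_atTop_nat 1)
    refine this.congr fun n => by simp
  refine ⟨⟨f, G, hf, hG, φ, h1, ?_, ?_⟩, rfl, rfl⟩
  · refine tendsto_of_tendsto_of_tendsto_of_le_of_le tendsto_const_nhds
      (by simpa using hz.add hu) (fun _ => zero_le) fun n => ?_
    refine le_trans ?_ (add_le_add (h2 n) le_rfl)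
    refine le_trans (le_of_eq ?_) (eLpNorm_add_le
      ((h1 n).1.continuous.aestronglyMeasurable.sub (u n).memLp_toFun.1)
      ((u n).memLp_toFun.1.sub hf.1) one_le_two)
    congr 1 with x
    simp
  · refine tendsto_of_tendsto_of_tendsto_of_le_of_le tendsto_const_nhds
      (by simpa using hz.add hu') (fun _ => zero_le) fun n => ?_
    refine le_trans ?_ (add_le_add (h3 n) le_rfl)
    refine le_trans (le_of_eq ?_) (eLpNorm_add_le
      ((measurable_gradient _).aestronglyMeasurable.sub (u n).memLp_grad.1)
      ((u n).memLp_grad.1.sub hG.1) one_le_two)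
    congr 1 with x
    simp

theorem IsTestFunction.differentiable {φ : E → ℝ} (h : IsTestFunction Ω φ) :
    Differentiable ℝ φ := h.1.differentiable (by simp)

theorem IsTestFunction.linComb {φ χ : E → ℝ} (h : IsTestFunction Ω φ) (k : IsTestFunction Ω χ)
    (s : ℝ) : IsTestFunction Ω (fun x => φ x + s * χ x) := by
  refine ⟨h.1.add (contDiff_const.mul k.1), h.2.1.add k.2.1.mul_left, ?_⟩
  refine (tsupport_add φ _).trans (union_subset h.2.2 ?_)
  exact (tsupport_mul_subset_right (f := fun _ => s) (g := χ)).trans k.2.2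

theorem IsTestFunction.gradient_linComb {φ χ : E → ℝ} (h : IsTestFunction Ω φ)
    (k : IsTestFunction Ω χ) (s : ℝ) (x : E) :
    gradient (fun x => φ x + s * χ x) x = gradient φ x + s • gradient χ x := by
  have h1 := (h.differentiable x).hasGradientAt.hasFDerivAt
  have h2 := ((k.differentiable x).hasGradientAt.hasFDerivAt).const_mul s
  have h3 : HasGradientAt (fun x => φ x + s * χ x) (gradient φ x + s • gradient χ x) x := by
    rw [hasGradientAt_iff_hasFDerivAt, map_add, map_smulₛₗ]
    exact h1.add h2
  exact h3.gradient

/-- The element `u + s w` of `H¹₀(Ω)`. -/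
def H10.linComb (u w : H10 Ω) (s : ℝ) : H10 Ω where
  toFun := fun x => u.toFun x + s * w.toFun x
  grad := fun x => u.grad x + s • w.grad x
  memLp_toFun := u.memLp_toFun.add (w.memLp_toFun.const_mul s)
  memLp_grad := u.memLp_grad.add (w.memLp_grad.const_smul s)
  exists_approx := by
    obtain ⟨φ, h1, h2, h3⟩ := u.exists_approx
    obtain ⟨χ, k1, k2, k3⟩ := w.exists_approx
    refine ⟨fun n x => φ n x + s * χ n x, fun n => (h1 n).linComb (k1 n) s, ?_, ?_⟩
    · have := h2.add (ENNReal.Tendsto.const_mul k2 (a := ‖s‖ₑ) (by simp))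
      simp only [mul_zero, add_zero] at this
      refine tendsto_of_tendsto_of_tendsto_of_le_of_le tendsto_const_nhds this
        (fun _ => zero_le) fun n => ?_
      dsimp only
      rw [← eLpNorm_const_smul]
      refine le_trans (le_of_eq ?_) (eLpNorm_add_le
        ((h1 n).1.continuous.aestronglyMeasurable.sub u.memLp_toFun.1)
        (((k1 n).1.continuous.aestronglyMeasurable.sub w.memLp_toFun.1).const_smul s) one_le_two)
      congr 1 with x
      simp; ring
    · have := h3.add (ENNReal.Tendsto.const_mul k3 (a := ‖s‖ₑ) (by simp))
      simp only [mul_zero, add_zero] at this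
      refine tendsto_of_tendsto_of_tendsto_of_le_of_le tendsto_const_nhds this
        (fun _ => zero_le) fun n => ?_
      dsimp only
      rw [← eLpNorm_const_smul]
      refine le_trans (le_of_eq ?_) (eLpNorm_add_le
        ((measurable_gradient _).aestronglyMeasurable.sub u.memLp_grad.1)
        (((measurable_gradient _).aestronglyMeasurable.sub w.memLp_grad.1).const_smul s) one_le_two)
      congr 1 with x : 1
      rw [(h1 n).gradient_linComb (k1 n)]
      simp only [Pi.add_apply, Pi.smul_apply, smul_sub]
      abel

end Algebra

/-! ### Multiplication of `H¹₀` functions by Lipschitz cutoffs. -/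

section Multiplication

variable {d : ℕ} {Ω : Set (EuclideanSpace ℝ (Fin d))}

local notation "E" => EuclideanSpace ℝ (Fin d)

theorem LipschitzWith.exists_lipschitzWith_mul {f g : E → ℝ} {C D : ℝ≥0} (hf : LipschitzWith C f)
    (hg : LipschitzWith D g) {A B : ℝ} (hA : ∀ x, |f x| ≤ A) (hB : ∀ x, |g x| ≤ B) :
    ∃ K, LipschitzWith K (fun x => f x * g x) := by
  refine ⟨(A * D + B * C).toNNReal, LipschitzWith.of_dist_le_mul fun x y => ?_⟩
  have h1 := hf.dist_le_mul x y
  have h2 := hg.dist_le_mul x y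
  rw [Real.dist_eq] at h1 h2 ⊢
  refine le_trans ?_ (mul_le_mul_of_nonneg_right (Real.le_coe_toNNReal _) dist_nonneg)
  have h3 : f x * g x - f y * g y = f x * (g x - g y) + g y * (f x - f y) := by ring
  rw [h3]
  refine (abs_add_le _ _).trans ?_
  rw [abs_mul, abs_mul, add_mul, mul_assoc, mul_assoc]
  exact add_le_add (mul_le_mul (hA x) h2 (abs_nonneg _) ((abs_nonneg _).trans (hA x)))
    (mul_le_mul (hB y) h1 (abs_nonneg _) ((abs_nonneg _).trans (hB y)))

theorem gradient_mul {f g : E → ℝ} {x : E} (hf : DifferentiableAt ℝ f x)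
    (hg : DifferentiableAt ℝ g x) :
    gradient (fun x => f x * g x) x = f x • gradient g x + g x • gradient f x := by
  have h3 : HasGradientAt (fun x => f x * g x) (f x • gradient g x + g x • gradient f x) x := by
    rw [hasGradientAt_iff_hasFDerivAt, map_add, map_smulₛₗ, map_smulₛₗ]
    exact hf.hasGradientAt.hasFDerivAt.mul hg.hasGradientAt.hasFDerivAt
  exact h3.gradient

theorem IsTestFunction.exists_lipschitzWith {φ : E → ℝ} (h : IsTestFunction Ω φ) :
    ∃ C, LipschitzWith C φ :=
  ContDiff.lipschitzWith_of_hasCompactSupport h.2.1 h.1 (by simp)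

/-- The cutoff need not have compact support: multiplied by an approximating test function it is
Lipschitz with compact support in `Ω`, hence in `H¹₀`. The product rule holds almost everywhere by
Rademacher, and closedness of `H¹₀` gives the limit. -/
theorem H10.exists_mul (hΩo : IsOpen Ω) (hΩ : Bornology.IsBounded Ω) (u : H10 Ω) {η : E → ℝ}
    {C : ℝ≥0} (hη : LipschitzWith C η) (hη1 : ∀ x, |η x| ≤ 1) :
    ∃ w : H10 Ω, w.toFun = (fun x => η x * u.toFun x) ∧
      w.grad = fun x => η x • u.grad x + u.toFun x • gradient η x := by
  obtain ⟨φ, h1, h2, h3⟩ := u.exists_approx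
  have hηm : AEStronglyMeasurable η (volume.restrict Ω) := hη.continuous.aestronglyMeasurable
  have hgm : AEStronglyMeasurable (gradient η) (volume.restrict Ω) :=
    (measurable_gradient η).aestronglyMeasurable
  have key : ∀ n, ∃ v : H10 Ω, v.toFun = (fun x => η x * φ n x) ∧
      v.grad = gradient (fun x => η x * φ n x) := by
    intro n
    obtain ⟨D, hD⟩ := (h1 n).exists_lipschitzWith
    obtain ⟨B, hB⟩ := (h1 n).1.continuous.bounded_above_of_compact_support (h1 n).2.1
    obtain ⟨K, hK⟩ := hη.exists_lipschitzWith_mul hD hη1 hB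
    exact ⟨H10.ofLipschitz hΩo hΩ hK (h1 n).2.1.mul_left
      ((tsupport_mul_subset_right (f := η) (g := φ n)).trans (h1 n).2.2), rfl, rfl⟩
  choose v hv hv' using key
  refine H10.exists_of_tendsto ?_ ?_ v ?_ ?_
  · refine u.memLp_toFun.mono (hηm.mul u.memLp_toFun.1) (Eventually.of_forall fun x => ?_)
    rw [norm_mul]
    exact mul_le_of_le_one_left (norm_nonneg _) (hη1 x)
  · refine MemLp.add ?_ ?_
    · refine u.memLp_grad.mono (hηm.smul u.memLp_grad.1) (Eventually.of_forall fun x => ?_)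
      rw [norm_smul]
      exact mul_le_of_le_one_left (norm_nonneg _) (hη1 x)
    · refine (u.memLp_toFun.const_mul (C : ℝ)).mono (u.memLp_toFun.1.smul hgm)
        (Eventually.of_forall fun x => ?_)
      rw [norm_smul, norm_mul, mul_comm, NNReal.norm_eq]
      exact mul_le_mul_of_nonneg_right (hη.norm_gradient_le x) (norm_nonneg _)
  · refine tendsto_of_tendsto_of_tendsto_of_le_of_le tendsto_const_nhds h2 (fun _ => zero_le)
      fun n => eLpNorm_mono fun x => ?_
    rw [hv, ← mul_sub, norm_mul]
    exact mul_le_of_le_one_left (norm_nonneg _) (hη1 x)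
  · have hlim := h3.add (ENNReal.Tendsto.const_mul h2 (a := ‖(C : ℝ)‖ₑ) (by simp))
    simp only [mul_zero, add_zero] at hlim
    refine tendsto_of_tendsto_of_tendsto_of_le_of_le tendsto_const_nhds hlim
      (fun _ => zero_le) fun n => ?_
    have hae : ∀ᵐ x ∂(volume.restrict Ω), (v n).grad x - (η x • u.grad x + u.toFun x • gradient η x)
        = η x • (gradient (φ n) x - u.grad x) + (φ n x - u.toFun x) • gradient η x := by
      filter_upwards [ae_restrict_of_ae hη.ae_differentiableAt] with x hx
      rw [hv', gradient_mul hx ((h1 n).differentiable x), smul_sub, sub_smul]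
      abel
    dsimp only
    rw [eLpNorm_congr_ae hae, ← eLpNorm_const_smul]
    have hm1 := (measurable_gradient (φ n)).aestronglyMeasurable.sub u.memLp_grad.1
    have hm2 := (h1 n).1.continuous.aestronglyMeasurable.sub u.memLp_toFun.1
    refine (eLpNorm_add_le (hηm.smul hm1) (hm2.smul hgm) one_le_two).trans
      (add_le_add (eLpNorm_mono fun x => ?_) (eLpNorm_mono fun x => ?_))
    · simp only [Pi.smul_apply', norm_smul]
      exact mul_le_of_le_one_left (norm_nonneg _) (hη1 x)
    · simp only [Pi.smul_apply', Pi.smul_apply, norm_smul]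
      rw [mul_comm, NNReal.norm_eq]
      exact mul_le_mul_of_nonneg_right (hη.norm_gradient_le x) (norm_nonneg _)

end Multiplication

/-! ### The energy form and the Euler-Lagrange equation. -/

section Energy

variable {d : ℕ} {Ω : Set (EuclideanSpace ℝ (Fin d))}

local notation "E" => EuclideanSpace ℝ (Fin d)

/-- The bilinear form `uᵀ M v` on Euclidean vectors. -/
def matForm (M : Matrix (Fin d) (Fin d) ℝ) (u v : E) : ℝ := ⇑u ⬝ᵥ (M *ᵥ ⇑v)

theorem matForm_add_left (M : Matrix (Fin d) (Fin d) ℝ) (u v w : E) :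
    matForm M (u + v) w = matForm M u w + matForm M v w := by
  simp [matForm, add_dotProduct]

theorem matForm_smul_left (M : Matrix (Fin d) (Fin d) ℝ) (s : ℝ) (u w : E) :
    matForm M (s • u) w = s * matForm M u w := by
  simp [matForm]

theorem matForm_add_right (M : Matrix (Fin d) (Fin d) ℝ) (u v w : E) :
    matForm M w (u + v) = matForm M w u + matForm M w v := by
  simp [matForm, Matrix.mulVec_add]

theorem matForm_smul_right (M : Matrix (Fin d) (Fin d) ℝ) (s : ℝ) (u w : E) :
    matForm M w (s • u) = s * matForm M w u := by
  simp [matForm, Matrix.mulVec_smul]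

theorem matForm_comm {M : Matrix (Fin d) (Fin d) ℝ} (hM : M.IsSymm) (u v : E) :
    matForm M u v = matForm M v u := by
  rw [matForm, matForm, Matrix.dotProduct_mulVec, ← Matrix.mulVec_transpose, hM.eq,
    dotProduct_comm]

theorem matForm_sq_le {M : Matrix (Fin d) (Fin d) ℝ} (hM : M.IsSymm)
    (hpos : ∀ u : E, 0 ≤ matForm M u u) (u v : E) :
    matForm M u v ^ 2 ≤ matForm M u u * matForm M v v := by
  have h : ∀ t : ℝ, 0 ≤ matForm M v v * (t * t) + (2 * matForm M u v) * t + matForm M u u := by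
    intro t
    have := hpos (u + t • v)
    rw [matForm_add_left, matForm_add_right, matForm_add_right, matForm_smul_left,
      matForm_smul_left, matForm_smul_right, matForm_smul_right, matForm_comm hM v u] at this
    linarith
  have := discrim_le_zero h
  rw [discrim] at this
  linarith

/-- Cauchy-Schwarz for the form, with only one factor replaced by its Euclidean bound. The other
stays as an energy density, so later estimates lose a single `√lmax`. -/
theorem abs_matForm_le {M : Matrix (Fin d) (Fin d) ℝ} (hM : M.IsSymm) {lmax : ℝ}
    (hpos : ∀ u : E, 0 ≤ matForm M u u) (hup : ∀ u : E, matForm M u u ≤ lmax * ‖u‖ ^ 2) (u v : E) :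
    |matForm M u v| ≤ √lmax * ‖u‖ * √(matForm M v v) := by
  have h : |matForm M u v| ≤ √(‖u‖ ^ 2 * (lmax * matForm M v v)) := by
    refine Real.abs_le_sqrt ((matForm_sq_le hM hpos u v).trans ?_)
    nlinarith [hup u, hpos v]
  rw [Real.sqrt_mul (sq_nonneg _), Real.sqrt_sq (norm_nonneg _), Real.sqrt_mul' _ (hpos v)] at h
  exact h.trans_eq (by ring)

variable {a : EuclideanSpace ℝ (Fin d) → Matrix (Fin d) (Fin d) ℝ} {lmin lmax : ℝ}

theorem IsUniformlyElliptic.ae_nonneg (ha : IsUniformlyElliptic Ω a lmin lmax) :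
    ∀ᵐ x ∂(volume.restrict Ω), ∀ u : E, 0 ≤ matForm (a x) u u := by
  filter_upwards [ha.lower] with x hx u
  exact le_trans (mul_nonneg ha.lmin_pos.le (sq_nonneg _)) (hx u)

theorem IsUniformlyElliptic.ae_abs_le (ha : IsUniformlyElliptic Ω a lmin lmax) :
    ∀ᵐ x ∂(volume.restrict Ω), ∀ u v : E,
      |matForm (a x) u v| ≤ √lmax * ‖u‖ * √(matForm (a x) v v) := by
  filter_upwards [ha.symm, ha.ae_nonneg, ha.upper] with x h1 h2 h3 u v
  exact abs_matForm_le h1 h2 h3 u v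

theorem IsUniformlyElliptic.aestronglyMeasurable (ha : IsUniformlyElliptic Ω a lmin lmax)
    {g h : E → E} (hg : AEStronglyMeasurable g (volume.restrict Ω))
    (hh : AEStronglyMeasurable h (volume.restrict Ω)) :
    AEStronglyMeasurable (fun x => matForm (a x) (g x) (h x)) (volume.restrict Ω) := by
  have hc : ∀ {g : E → E}, AEStronglyMeasurable g (volume.restrict Ω) → ∀ p : Fin d,
      AEMeasurable (fun x => g x p) (volume.restrict Ω) := fun hg p =>
    ((EuclideanSpace.proj p : E →L[ℝ] ℝ).continuous.comp_aestronglyMeasurable hg).aemeasurable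
  refine AEMeasurable.aestronglyMeasurable ?_
  change AEMeasurable (fun x => ∑ p, g x p * ∑ q, a x p q * h x q) (volume.restrict Ω)
  refine Finset.aemeasurable_fun_sum _ fun p _ => (hc hg p).mul ?_
  exact Finset.aemeasurable_fun_sum _ fun q _ => (ha.aemeasurable p q).mul (hc hh q)

theorem IsUniformlyElliptic.integrable (ha : IsUniformlyElliptic Ω a lmin lmax) {g h : E → E}
    (hg : MemLp g 2 (volume.restrict Ω)) (hh : MemLp h 2 (volume.restrict Ω)) :
    Integrable (fun x => matForm (a x) (g x) (h x)) (volume.restrict Ω) := by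
  refine ((hg.norm.integrable_mul hh.norm).const_mul (√lmax * √lmax)).mono'
    (ha.aestronglyMeasurable hg.1 hh.1) ?_
  filter_upwards [ha.ae_abs_le, ha.upper] with x hx hu
  refine (hx _ _).trans ?_
  have h1 : √(matForm (a x) (h x) (h x)) ≤ √lmax * ‖h x‖ := by
    refine (Real.sqrt_le_sqrt (hu (h x))).trans (le_of_eq ?_)
    rw [Real.sqrt_mul' _ (sq_nonneg _), Real.sqrt_sq (norm_nonneg _)]
  calc _ ≤ √lmax * ‖g x‖ * (√lmax * ‖h x‖) := by gcongr
    _ = _ := by simp only [Pi.mul_apply]; ring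

theorem energyOn_eq (S : Set E) (ψ : H10 Ω) :
    energyOn a S ψ = ∫ x in S, matForm (a x) (ψ.grad x) (ψ.grad x) := rfl

theorem energyOn_nonneg (ha : IsUniformlyElliptic Ω a lmin lmax) {S : Set E} (hS : S ⊆ Ω)
    (ψ : H10 Ω) : 0 ≤ energyOn a S ψ := by
  rw [energyOn_eq]
  refine integral_nonneg_of_ae (ae_restrict_of_ae_restrict_of_subset hS ?_)
  filter_upwards [ha.ae_nonneg] with x hx using hx _

theorem energyOn_linComb (ha : IsUniformlyElliptic Ω a lmin lmax) (ψ w : H10 Ω) (s : ℝ) :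
    energyOn a Ω (ψ.linComb w s) = energyOn a Ω ψ +
      2 * s * (∫ x in Ω, matForm (a x) (w.grad x) (ψ.grad x)) + s ^ 2 * energyOn a Ω w := by
  have h1 := ha.integrable ψ.memLp_grad ψ.memLp_grad
  have h2 := ha.integrable w.memLp_grad ψ.memLp_grad
  have h3 := ha.integrable w.memLp_grad w.memLp_grad
  simp only [energyOn_eq]
  rw [← integral_const_mul, ← integral_const_mul, ← integral_add h1 (h2.const_mul _)]
  refine Eq.trans ?_ (integral_add (h1.add (h2.const_mul _)) (h3.const_mul _))
  refine integral_congr_ae ?_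
  filter_upwards [ha.symm] with x hx
  simp only [H10.linComb]
  rw [matForm_add_left, matForm_add_right, matForm_add_right, matForm_smul_left,
      matForm_smul_left, matForm_smul_right, matForm_smul_right, matForm_comm hx (ψ.grad x) (w.grad x)]
  ring

variable {m : ℕ} {τ : Fin m → Set (EuclideanSpace ℝ (Fin d))} {H δ : ℝ}

theorem IsCellPartition.nullMeasurableSet (hτ : IsCellPartition Ω τ H δ) (j : Fin m) :
    NullMeasurableSet (τ j) volume := (hτ.convex j).nullMeasurableSet volume

theorem integral_measurementFun_mul (hτ : IsCellPartition Ω τ H δ) (j : Fin m) (f : E → ℝ) :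
    ∫ x in Ω, measurementFun τ j x * f x = ∫ x in τ j, f x := by
  have h : (fun x => measurementFun τ j x * f x) = (τ j).indicator f := by
    ext x
    by_cases hx : x ∈ τ j <;> simp [measurementFun, hx]
  rw [h, integral_indicator₀ ((hτ.nullMeasurableSet j).mono Measure.restrict_le_self),
    Measure.restrict_restrict₀ ((hτ.nullMeasurableSet j).mono Measure.restrict_le_self),
    inter_eq_left.2 (hτ.subset j)]

theorem H10.integrable (hΩ : Bornology.IsBounded Ω) (u : H10 Ω) :
    Integrable u.toFun (volume.restrict Ω) := by
  have hfin : IsFiniteMeasure (volume.restrict Ω) := ⟨by simpa using hΩ.measure_lt_top⟩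
  exact u.memLp_toFun.integrable one_le_two

theorem H10.integrableOn (hΩ : Bornology.IsBounded Ω) (u : H10 Ω) {S : Set E} (hS : S ⊆ Ω) :
    IntegrableOn u.toFun S volume := IntegrableOn.mono_set (u.integrable hΩ) hS

/-- The Euler-Lagrange equation of the constrained minimization. -/
theorem IsGamblet.integral_matForm_eq_zero (ha : IsUniformlyElliptic Ω a lmin lmax)
    (hΩ : Bornology.IsBounded Ω) (hτ : IsCellPartition Ω τ H δ) {i : Fin m} {ψ : H10 Ω}
    (hψ : IsGamblet a (measurementFun τ) i ψ) (w : H10 Ω) (hw : ∀ j, ∫ x in τ j, w.toFun x = 0) :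
    ∫ x in Ω, matForm (a x) (w.grad x) (ψ.grad x) = 0 := by
  -- `ψ + s w` is admissible for every `s`, so the energy increment is a nonnegative quadratic in
  -- `s` without constant term; its discriminant forces the linear coefficient to vanish.
  have hmin : ∀ s : ℝ, 0 ≤ energyOn a Ω w * (s * s)
      + (2 * ∫ x in Ω, matForm (a x) (w.grad x) (ψ.grad x)) * s + 0 := by
    intro s
    have hc : SatisfiesConstraints (measurementFun τ) i (ψ.linComb w s) := by
      intro j
      rw [← hψ.1 j, integral_measurementFun_mul hτ, integral_measurementFun_mul hτ]
      simp only [H10.linComb]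
      rw [integral_add (ψ.integrableOn hΩ (hτ.subset j))
        ((w.integrableOn hΩ (hτ.subset j)).const_mul s), integral_const_mul, hw j]
      simp
    have h1 := hψ.2 _ hc
    rw [energyNorm, energyNorm, Real.sqrt_le_sqrt_iff (energyOn_nonneg ha le_rfl _),
      energyOn_linComb ha] at h1
    linarith
  have := discrim_le_zero hmin
  rw [discrim] at this
  have h2 : (∫ x in Ω, matForm (a x) (w.grad x) (ψ.grad x)) ^ 2 ≤ 0 := by linarith
  exact pow_eq_zero_iff (two_ne_zero) |>.1 (le_antisymm h2 (sq_nonneg _))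

end Energy

/-! ### A Poincaré inequality for smooth functions on convex sets. -/

section Poincare

variable {d : ℕ}

local notation "E" => EuclideanSpace ℝ (Fin d)

/-- The integral of `t ^ (-d/2)` over `[1/2, 1]`. -/
def halfPowIntegral (d : ℕ) : ℝ := ∫ t in (1 / 2 : ℝ)..1, t ^ (-((d : ℝ) / 2))

theorem continuousOn_rpow_half (p : ℝ) : ContinuousOn (fun t : ℝ => t ^ p) (uIcc (1 / 2) 1) := by
  intro t ht
  rw [uIcc_of_le (by norm_num)] at ht
  exact (Real.continuousAt_rpow_const t p (Or.inl (by linarith [ht.1]))).continuousWithinAt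

theorem halfPowIntegral_pos (d : ℕ) : 0 < halfPowIntegral d := by
  refine intervalIntegral.intervalIntegral_pos_of_pos_on
    (continuousOn_rpow_half _).intervalIntegrable (fun t ht => ?_) (by norm_num)
  exact Real.rpow_pos_of_pos (by linarith [ht.1]) _

theorem ContDiff.continuous_gradient {u : E → ℝ} (hu : ContDiff ℝ 1 u) :
    Continuous (gradient u) :=
  (InnerProductSpace.toDual ℝ E).symm.continuous.comp (hu.continuous_fderiv one_ne_zero)

/-- A weighted Cauchy-Schwarz bound for the increment of `u` over the second half of a segment. -/
theorem sq_sub_midpoint_le {u : E → ℝ} (hu : ContDiff ℝ 1 u) {H : ℝ} (x y : E)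
    (hxy : ‖y - x‖ ≤ H) :
    (u y - u (x + (1 / 2 : ℝ) • (y - x))) ^ 2 ≤ H ^ 2 * halfPowIntegral d *
      ∫ t in (1 / 2 : ℝ)..1, t ^ ((d : ℝ) / 2) * ‖gradient u (x + t • (y - x))‖ ^ 2 := by
  set γ : ℝ → E := fun t => x + t • (y - x) with hγ
  set h : ℝ → ℝ := fun t => inner ℝ (gradient u (γ t)) (y - x) with hh
  have hγc : Continuous γ := by fun_prop
  have hhc : Continuous h := (hu.continuous_gradient.comp hγc).inner continuous_const
  have hderiv : ∀ t, HasDerivAt (fun t => u (γ t)) (h t) t := by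
    intro t
    have h1 : HasDerivAt γ (y - x) t := by
      have h0 := ((hasDerivAt_id t).smul_const (y - x)).const_add x
      rw [one_smul] at h0
      exact h0
    have h2 := ((hu.differentiable one_ne_zero) (γ t)).hasGradientAt.hasFDerivAt
    have h3 := h2.comp_hasDerivAt t h1
    rw [InnerProductSpace.toDual_apply_apply] at h3
    exact h3
  have hint : ∫ t in (1 / 2 : ℝ)..1, h t = u y - u (x + (1 / 2 : ℝ) • (y - x)) := by
    rw [intervalIntegral.integral_eq_sub_of_hasDerivAt (fun t _ => hderiv t)
      (hhc.intervalIntegrable _ _)]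
    simp [hγ]
  set J := halfPowIntegral d with hJ
  have hJ0 : 0 < J := halfPowIntegral_pos d
  set Δ := u y - u (x + (1 / 2 : ℝ) • (y - x)) with hΔ
  -- The optimal parameter in `2ch ≤ t^(d/2) h² + c² t^(-d/2)`; after integration in `t` it yields
  -- the weighted Cauchy-Schwarz inequality.
  set c := Δ / J with hc
  have hI1 : IntervalIntegrable (fun t : ℝ => t ^ ((d : ℝ) / 2) * h t ^ 2) volume (1 / 2) 1 :=
    ((continuousOn_rpow_half _).mul (hhc.pow 2).continuousOn).intervalIntegrable
  have hI2 : IntervalIntegrable (fun t : ℝ => t ^ (-((d : ℝ) / 2))) volume (1 / 2) 1 :=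
    (continuousOn_rpow_half _).intervalIntegrable
  have hI3 : IntervalIntegrable (fun t : ℝ => t ^ ((d : ℝ) / 2) * ‖gradient u (γ t)‖ ^ 2) volume
      (1 / 2) 1 := ((continuousOn_rpow_half _).mul
        ((hu.continuous_gradient.comp hγc).norm.pow 2).continuousOn).intervalIntegrable
  have hmono : ∫ t in (1 / 2 : ℝ)..1, 2 * c * h t ≤
      ∫ t in (1 / 2 : ℝ)..1, (t ^ ((d : ℝ) / 2) * h t ^ 2 + c ^ 2 * t ^ (-((d : ℝ) / 2))) := by
    refine intervalIntegral.integral_mono_on (by norm_num)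
      ((hhc.intervalIntegrable _ _).const_mul _) (hI1.add (hI2.const_mul _)) fun t ht => ?_
    have ht0 : 0 < t := by linarith [ht.1]
    have hq : 0 < t ^ ((d : ℝ) / 2) := Real.rpow_pos_of_pos ht0 _
    rw [Real.rpow_neg ht0.le]
    set q := t ^ ((d : ℝ) / 2)
    have : q * h t ^ 2 + c ^ 2 * q⁻¹ - 2 * c * h t = q⁻¹ * (q * h t - c) ^ 2 := by
      field_simp
      ring
    have h0 : 0 ≤ q⁻¹ * (q * h t - c) ^ 2 := by positivity
    linarith
  rw [intervalIntegral.integral_const_mul, hint, intervalIntegral.integral_add hI1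
    (hI2.const_mul _), intervalIntegral.integral_const_mul] at hmono
  have hmono2 : ∫ t in (1 / 2 : ℝ)..1, t ^ ((d : ℝ) / 2) * h t ^ 2 ≤
      ∫ t in (1 / 2 : ℝ)..1, H ^ 2 * (t ^ ((d : ℝ) / 2) * ‖gradient u (γ t)‖ ^ 2) := by
    refine intervalIntegral.integral_mono_on (by norm_num) hI1 (hI3.const_mul _) fun t ht => ?_
    have hq : 0 ≤ t ^ ((d : ℝ) / 2) := Real.rpow_nonneg (by linarith [ht.1]) _
    have h1 : |h t| ≤ ‖gradient u (γ t)‖ * H :=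
      (abs_real_inner_le_norm _ _).trans (mul_le_mul_of_nonneg_left hxy (norm_nonneg _))
    have h2 : h t ^ 2 ≤ (‖gradient u (γ t)‖ * H) ^ 2 := by
      rw [← sq_abs]; exact pow_le_pow_left₀ (abs_nonneg _) h1 2
    calc _ ≤ t ^ ((d : ℝ) / 2) * (‖gradient u (γ t)‖ * H) ^ 2 := mul_le_mul_of_nonneg_left h2 hq
      _ = _ := by ring
  rw [intervalIntegral.integral_const_mul] at hmono2
  change 2 * c * Δ ≤ _ + c ^ 2 * J at hmono
  have hcJ : c * J = Δ := by rw [hc]; field_simp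
  have h4 : c ^ 2 * J = c * Δ := by rw [sq, mul_assoc, hcJ]
  have h5 : c * Δ ≤ H ^ 2 * ∫ t in (1 / 2 : ℝ)..1, t ^ ((d : ℝ) / 2) * ‖gradient u (γ t)‖ ^ 2 := by
    linarith
  calc Δ ^ 2 = J * (c * Δ) := by rw [← hcJ]; ring
    _ ≤ J * _ := mul_le_mul_of_nonneg_left h5 hJ0.le
    _ = _ := by ring

theorem integral_comp_segment (G : E → ℝ) (x : E) {t : ℝ} (ht : 0 < t) :
    ∫ y, G (x + t • (y - x)) = t ^ (-(d : ℝ)) * ∫ y, G y := by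
  rw [integral_sub_right_eq_self (fun y => G (x + t • y)) x,
    Measure.integral_comp_smul volume (fun z => G (x + z)) t, integral_add_left_eq_self G x]
  rw [finrank_euclideanSpace_fin, abs_of_pos (by positivity), smul_eq_mul, Real.rpow_neg ht.le,
    Real.rpow_natCast]

/-- Integrate the segment bound over `y` and exchange the integrals. For fixed `t`, contracting `S`
towards `x` stays in `S` by convexity and costs the Jacobian `t^(-d)`. With the weight `t^(d/2)`
this leaves `t^(-d/2)`, whose integral is the second factor `halfPowIntegral d`. Keeping `t ≥ 1/2`
avoids the singularity at `0`. -/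
theorem integral_sq_sub_midpoint_le {u : E → ℝ} (hu : ContDiff ℝ 1 u) {H : ℝ} {S : Set E}
    (hSo : IsOpen S) (hSb : Bornology.IsBounded S) (hSc : Convex ℝ S)
    (hH : ∀ x ∈ S, ∀ y ∈ S, ‖y - x‖ ≤ H) {x : E} (hx : x ∈ S) :
    ∫ y in S, (u y - u (x + (1 / 2 : ℝ) • (y - x))) ^ 2 ≤
      H ^ 2 * halfPowIntegral d ^ 2 * ∫ y in S, ‖gradient u y‖ ^ 2 := by
  have hfin : IsFiniteMeasure (volume.restrict S) := ⟨by simpa using hSb.measure_lt_top⟩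
  set J := halfPowIntegral d with hJ
  have hJ0 : 0 < J := halfPowIntegral_pos d
  -- Extension by zero lets the change of variables be made on the whole space.
  set G : E → ℝ := S.indicator fun y => ‖gradient u y‖ ^ 2 with hG
  have hG0 : ∀ y, 0 ≤ G y := fun y => indicator_nonneg (fun _ _ => sq_nonneg _) y
  have hcomp : IsCompact (closure S) := hSb.isCompact_closure
  obtain ⟨M, hM⟩ := hcomp.exists_bound_of_continuousOn
    (hu.continuous_gradient.norm.pow 2).continuousOn
  have hM0 : 0 ≤ M := (norm_nonneg _).trans (hM x (subset_closure hx))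
  have hGM : ∀ y, ‖G y‖ ≤ M := by
    intro y
    by_cases hy : y ∈ S
    · simpa [hG, hy] using hM y (subset_closure hy)
    · simpa [hG, hy] using hM0
  have hGm : Measurable G := (hu.continuous_gradient.norm.pow 2).measurable.indicator
    hSo.measurableSet
  have hGi : Integrable G volume := by
    rw [hG, integrable_indicator_iff hSo.measurableSet]
    exact ((hu.continuous_gradient.norm.pow 2).continuousOn.integrableOn_compact hcomp).mono_set
      subset_closure
  have hseg : ∀ y ∈ S, ∀ t ∈ Icc (0 : ℝ) 1, x + t • (y - x) ∈ S := fun y hy t ht =>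
    hSc.add_smul_sub_mem hx hy ht
  set F : E → ℝ → ℝ := fun y t => t ^ ((d : ℝ) / 2) * G (x + t • (y - x)) with hF
  have hFm : Measurable (Function.uncurry F) := by
    refine (measurable_snd.pow_const _).mul (hGm.comp ?_)
    fun_prop
  have hFi : Integrable (Function.uncurry F)
      ((volume.restrict S).prod (volume.restrict (Ioc (1 / 2 : ℝ) 1))) := by
    refine Integrable.of_bound hFm.aestronglyMeasurable M ?_
    have hprod : ∀ᵐ q ∂((volume.restrict S).prod (volume.restrict (Ioc (1 / 2 : ℝ) 1))),
        q ∈ S ×ˢ Ioc (1 / 2 : ℝ) 1 := by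
      rw [Measure.prod_restrict]
      exact ae_restrict_mem (hSo.measurableSet.prod measurableSet_Ioc)
    filter_upwards [hprod] with q hq
    have h1 : 0 < q.2 := by linarith [hq.2.1]
    have h2 : q.2 ^ ((d : ℝ) / 2) ≤ 1 := Real.rpow_le_one h1.le hq.2.2 (by positivity)
    simp only [Function.uncurry, hF, norm_mul]
    rw [Real.norm_of_nonneg (Real.rpow_nonneg h1.le _)]
    exact (mul_le_of_le_one_left (norm_nonneg _) h2).trans (hGM _)
  have hstep : ∀ y ∈ S, (u y - u (x + (1 / 2 : ℝ) • (y - x))) ^ 2 ≤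
      H ^ 2 * J * ∫ t in Ioc (1 / 2 : ℝ) 1, F y t := by
    intro y hy
    refine (sq_sub_midpoint_le hu x y (hH x hx y hy)).trans (le_of_eq ?_)
    rw [intervalIntegral.integral_of_le (by norm_num)]
    congr 1
    refine setIntegral_congr_fun measurableSet_Ioc fun t ht => ?_
    have := hseg y hy t ⟨by linarith [ht.1], ht.2⟩
    simp [hF, hG, this]
  have hinner : ∀ t ∈ Ioc (1 / 2 : ℝ) 1, ∫ y in S, F y t ≤
      t ^ (-((d : ℝ) / 2)) * ∫ y, G y := by
    intro t ht
    have ht0 : 0 < t := by linarith [ht.1]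
    have hci : Integrable (fun y => G (x + t • (y - x))) volume :=
      ((hGi.comp_add_left x).comp_smul ht0.ne').comp_sub_right x
    simp only [hF]
    rw [integral_const_mul]
    calc _ ≤ t ^ ((d : ℝ) / 2) * ∫ y, G (x + t • (y - x)) :=
          mul_le_mul_of_nonneg_left (setIntegral_le_integral hci
            (Eventually.of_forall fun y => hG0 _)) (Real.rpow_nonneg ht0.le _)
      _ = _ := by
          rw [integral_comp_segment G x ht0, ← mul_assoc, ← Real.rpow_add ht0]
          congr 2
          ring
  have hleft : IntegrableOn (fun y => (u y - u (x + (1 / 2 : ℝ) • (y - x))) ^ 2) S volume := by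
    have hc : Continuous (fun y => (u y - u (x + (1 / 2 : ℝ) • (y - x))) ^ 2) := by
      have := hu.continuous
      fun_prop
    exact (hc.continuousOn.integrableOn_compact hcomp).mono_set subset_closure
  calc ∫ y in S, (u y - u (x + (1 / 2 : ℝ) • (y - x))) ^ 2
      ≤ ∫ y in S, H ^ 2 * J * ∫ t in Ioc (1 / 2 : ℝ) 1, F y t :=
        setIntegral_mono_on hleft (hFi.integral_prod_left.const_mul _) hSo.measurableSet hstep
    _ = H ^ 2 * J * ∫ t in Ioc (1 / 2 : ℝ) 1, ∫ y in S, F y t := by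
        rw [integral_const_mul, integral_integral_swap hFi]
    _ ≤ H ^ 2 * J * ∫ t in Ioc (1 / 2 : ℝ) 1, t ^ (-((d : ℝ) / 2)) * ∫ y, G y := by
        refine mul_le_mul_of_nonneg_left ?_ (by positivity)
        refine setIntegral_mono_on hFi.integral_prod_right ?_ measurableSet_Ioc hinner
        exact (((continuousOn_rpow_half _).intervalIntegrable).1).mul_const _
    _ = H ^ 2 * J ^ 2 * ∫ y in S, ‖gradient u y‖ ^ 2 := by
        rw [integral_mul_const, ← intervalIntegral.integral_of_le (by norm_num), hG,
          integral_indicator hSo.measurableSet]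
        change _ * (J * _) = _
        ring

/-- The left side is half the double integral of `(u x - u y)²`. Comparing both endpoints with the
value at their midpoint uses only the half of the segment far from the other endpoint, so the
previous estimate applies twice, with the roles of `x` and `y` exchanged. -/
theorem poincare_of_contDiff {u : E → ℝ} (hu : ContDiff ℝ 1 u) {H : ℝ} {S : Set E}
    (hSo : IsOpen S) (hSb : Bornology.IsBounded S) (hSc : Convex ℝ S)
    (hH : ∀ x ∈ S, ∀ y ∈ S, ‖y - x‖ ≤ H) :
    volume.real S * (∫ y in S, u y ^ 2) - (∫ y in S, u y) ^ 2 ≤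
      2 * H ^ 2 * halfPowIntegral d ^ 2 * volume.real S * ∫ y in S, ‖gradient u y‖ ^ 2 := by
  have hfin : IsFiniteMeasure (volume.restrict S) := ⟨by simpa using hSb.measure_lt_top⟩
  have hcomp : IsCompact (closure S) := hSb.isCompact_closure
  have hi : ∀ {f : E → ℝ}, Continuous f → IntegrableOn f S volume := fun hf =>
    (hf.continuousOn.integrableOn_compact hcomp).mono_set subset_closure
  have hi2 : ∀ {f : E × E → ℝ}, Continuous f →
      Integrable f ((volume.restrict S).prod (volume.restrict S)) := by
    intro f hf
    rw [Measure.prod_restrict]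
    exact (hf.continuousOn.integrableOn_compact (hcomp.prod hcomp)).mono_set
      (prod_mono subset_closure subset_closure)
  have huc := hu.continuous
  set K := H ^ 2 * halfPowIntegral d ^ 2 * ∫ y in S, ‖gradient u y‖ ^ 2 with hK
  set P : E → E → ℝ := fun x y => (u y - u (x + (1 / 2 : ℝ) • (y - x))) ^ 2 with hP
  have hPc : Continuous (Function.uncurry P) := by
    simp only [hP, Function.uncurry_def]; fun_prop
  have hPc' : Continuous (Function.uncurry fun x y => P y x) := by
    simp only [hP, Function.uncurry_def]; fun_prop
  have hPint : ∫ x in S, ∫ y in S, P x y ≤ volume.real S * K := by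
    calc _ ≤ ∫ x in S, K := setIntegral_mono_on (hi2 hPc).integral_prod_left
          (integrable_const _) hSo.measurableSet
          fun x hx => integral_sq_sub_midpoint_le hu hSo hSb hSc hH hx
      _ = _ := by simp
  have hexp : ∫ x in S, ∫ y in S, (u x - u y) ^ 2 =
      2 * (volume.real S * (∫ y in S, u y ^ 2) - (∫ y in S, u y) ^ 2) := by
    have h1 : ∀ x, ∫ y in S, (u x - u y) ^ 2 =
        volume.real S * u x ^ 2 - 2 * (∫ y in S, u y) * u x + ∫ y in S, u y ^ 2 := by
      intro x
      have : ∀ y, (u x - u y) ^ 2 = u x ^ 2 - 2 * u x * u y + u y ^ 2 := fun y => by ring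
      simp only [this]
      have e1 : IntegrableOn (fun y => 2 * u x * u y) S volume := (hi huc).const_mul _
      have e2 : IntegrableOn (fun y => u x ^ 2 - 2 * u x * u y) S volume :=
        (integrable_const _).sub e1
      have e3 : IntegrableOn (fun y => u y ^ 2) S volume := hi (huc.pow 2)
      rw [integral_add e2 e3, integral_sub (integrable_const _) e1, integral_const_mul,
        setIntegral_const, smul_eq_mul]
      ring
    simp only [h1]
    have e1 : IntegrableOn (fun x => volume.real S * u x ^ 2) S volume :=
      (hi (huc.pow 2)).const_mul _
    have e2 : IntegrableOn (fun x => 2 * (∫ y in S, u y) * u x) S volume := (hi huc).const_mul _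
    have e3 : IntegrableOn (fun x => volume.real S * u x ^ 2 - 2 * (∫ y in S, u y) * u x) S
      volume := e1.sub e2
    rw [integral_add e3 (integrable_const _), integral_sub e1 e2, integral_const_mul,
      integral_const_mul, setIntegral_const, smul_eq_mul]
    ring
  have hle : ∫ x in S, ∫ y in S, (u x - u y) ^ 2 ≤ ∫ x in S, ∫ y in S, (2 * P y x + 2 * P x y) := by
    have hc1 : Continuous (Function.uncurry fun x y => (u x - u y) ^ 2) := by
      simp only [Function.uncurry_def]; fun_prop
    have hc2 : Continuous (Function.uncurry fun x y => 2 * P y x + 2 * P x y) :=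
      (continuous_const.mul hPc').add (continuous_const.mul hPc)
    refine integral_mono (hi2 hc1).integral_prod_left (hi2 hc2).integral_prod_left fun x => ?_
    refine integral_mono (hi (hc1.comp (by fun_prop : Continuous fun y => (x, y))))
      (hi (hc2.comp (by fun_prop : Continuous fun y => (x, y)))) fun y => ?_
    have hmid : y + (1 / 2 : ℝ) • (x - y) = x + (1 / 2 : ℝ) • (y - x) := by module
    simp only [hP, hmid]
    set c := u (x + (1 / 2 : ℝ) • (y - x))
    nlinarith [sq_nonneg (u x - c + (u y - c))]
  have hsum : ∫ x in S, ∫ y in S, (2 * P y x + 2 * P x y) = 4 * ∫ x in S, ∫ y in S, P x y := by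
    have h1 : ∀ x, ∫ y in S, (2 * P y x + 2 * P x y) =
        2 * (∫ y in S, P y x) + 2 * ∫ y in S, P x y := by
      intro x
      rw [integral_add, integral_const_mul, integral_const_mul]
      · exact (hi (hPc'.comp (by fun_prop : Continuous fun y => (x, y)))).const_mul _
      · exact (hi (hPc.comp (by fun_prop : Continuous fun y => (x, y)))).const_mul _
    simp only [h1]
    have e1 : IntegrableOn (fun x => 2 * ∫ y in S, P y x) S volume :=
      (hi2 hPc').integral_prod_left.const_mul _
    have e2 : IntegrableOn (fun x => 2 * ∫ y in S, P x y) S volume :=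
      (hi2 hPc).integral_prod_left.const_mul _
    rw [integral_add e1 e2, integral_const_mul, integral_const_mul,
      integral_integral_swap (hi2 hPc')]
    ring
  rw [hexp, hsum] at hle
  rw [hK] at hPint
  linarith

end Poincare

/-! ### Cauchy-Schwarz and `L²` limits of integrals. -/

section SquareIntegrable

variable {α : Type*} [MeasurableSpace α] {μ : Measure α}

theorem sq_integral_mul_le {f g : α → ℝ} (hf : MemLp f 2 μ) (hg : MemLp g 2 μ) :
    (∫ x, f x * g x ∂μ) ^ 2 ≤ (∫ x, f x ^ 2 ∂μ) * ∫ x, g x ^ 2 ∂μ := by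
  have h : ∀ t : ℝ, 0 ≤ (∫ x, g x ^ 2 ∂μ) * (t * t) + (2 * ∫ x, f x * g x ∂μ) * t
      + ∫ x, f x ^ 2 ∂μ := by
    intro t
    have e1 : Integrable (fun x => g x ^ 2 * (t * t)) μ := hg.integrable_sq.mul_const _
    have e2 : Integrable (fun x => f x * g x * (2 * t)) μ := (hf.integrable_mul hg).mul_const _
    have e3 : Integrable (fun x => g x ^ 2 * (t * t) + f x * g x * (2 * t)) μ := e1.add e2
    have h1 : 0 ≤ ∫ x, (g x ^ 2 * (t * t) + f x * g x * (2 * t) + f x ^ 2) ∂μ :=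
      integral_nonneg fun x => by
        have : g x ^ 2 * (t * t) + f x * g x * (2 * t) + f x ^ 2 = (f x + t * g x) ^ 2 := by ring
        simp only [this, Pi.zero_apply]
        positivity
    rw [integral_add e3 hf.integrable_sq, integral_add e1 e2, integral_mul_const,
      integral_mul_const] at h1
    linarith
  have := discrim_le_zero h
  rw [discrim] at this
  linarith

theorem abs_integral_mul_le {f g : α → ℝ} (hf : MemLp f 2 μ) (hg : MemLp g 2 μ) :
    |∫ x, f x * g x ∂μ| ≤ √(∫ x, f x ^ 2 ∂μ) * √(∫ x, g x ^ 2 ∂μ) := by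
  rw [← Real.sqrt_mul (integral_nonneg fun x => sq_nonneg _)]
  exact Real.abs_le_sqrt (sq_integral_mul_le hf hg)

theorem tendsto_integral_norm_sq {F : Type*} [NormedAddCommGroup F] {f : ℕ → α → F} {g : α → F}
    (hf : ∀ n, MemLp (f n) 2 μ) (hg : MemLp g 2 μ)
    (h : Tendsto (fun n => eLpNorm (fun x => f n x - g x) 2 μ) atTop (𝓝 0)) :
    Tendsto (fun n => ∫ x, ‖f n x‖ ^ 2 ∂μ) atTop (𝓝 (∫ x, ‖g x‖ ^ 2 ∂μ)) := by
  have key : ∀ {f : α → F}, MemLp f 2 μ → lpNorm f 2 μ ^ 2 = ∫ x, ‖f x‖ ^ 2 ∂μ := by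
    intro f hf
    rw [lpNorm_eq_integral_norm_rpow_toReal two_ne_zero ENNReal.ofNat_ne_top hf.1]
    simp only [ENNReal.toReal_ofNat, Real.rpow_ofNat]
    rw [← Real.rpow_natCast, ← Real.rpow_mul (integral_nonneg fun x => by positivity)]
    simp
  have h1 := ((Lp.tendsto_Lp_iff_tendsto_eLpNorm'' f hf g hg).2 h).norm.pow 2
  refine (h1.congr fun n => ?_).trans (le_of_eq ?_)
  · rw [Lp.norm_toLp, ← key (hf n), toReal_eLpNorm (hf n).1]
  · rw [Lp.norm_toLp, ← key hg, toReal_eLpNorm hg.1]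

theorem tendsto_integral_of_L2 [IsFiniteMeasure μ] {f : ℕ → α → ℝ} {g : α → ℝ}
    (hf : ∀ n, MemLp (f n) 2 μ) (hg : MemLp g 2 μ)
    (h : Tendsto (fun n => eLpNorm (fun x => f n x - g x) 2 μ) atTop (𝓝 0)) :
    Tendsto (fun n => ∫ x, f n x ∂μ) atTop (𝓝 (∫ x, g x ∂μ)) := by
  refine tendsto_integral_of_L1' g hg.1
    (Eventually.of_forall fun n => (hf n).integrable one_le_two) ?_
  have hlim := ENNReal.Tendsto.mul_const h (b := μ univ ^ (1 / 1 - 1 / 2 : ℝ))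
    (Or.inr (ENNReal.rpow_ne_top_of_nonneg (by norm_num) (measure_ne_top μ univ)))
  rw [zero_mul] at hlim
  refine tendsto_of_tendsto_of_tendsto_of_le_of_le tendsto_const_nhds hlim
    (fun _ => zero_le) fun n => ?_
  have := eLpNorm_le_eLpNorm_mul_rpow_measure_univ (p := 1) (q := 2) one_le_two
    ((hf n).sub hg).1
  simp only [ENNReal.toReal_one, ENNReal.toReal_ofNat] at this
  exact this

end SquareIntegrable

/-! ### Poincaré inequality and gauge bubbles on convex cells. -/

section Cells

variable {d : ℕ} {Ω : Set (EuclideanSpace ℝ (Fin d))}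

local notation "E" => EuclideanSpace ℝ (Fin d)

theorem IsTestFunction.memLp {φ : E → ℝ} (h : IsTestFunction Ω φ) (S : Set E) :
    MemLp φ 2 (volume.restrict S) :=
  (h.1.continuous.memLp_of_hasCompactSupport h.2.1).restrict S

theorem IsTestFunction.memLp_gradient {φ : E → ℝ} (h : IsTestFunction Ω φ) (S : Set E) :
    MemLp (gradient φ) 2 (volume.restrict S) := by
  have hc : HasCompactSupport (gradient φ) :=
    h.2.1.mono' ((subset_tsupport _).trans (tsupport_gradient_subset φ))
  exact ((h.1.of_le (by simp)).continuous_gradient.memLp_of_hasCompactSupport hc).restrict S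

/-- A Poincaré inequality on convex cells with a non-optimal constant. -/
theorem H10.poincare (u : H10 Ω) {S : Set E} (hS : S ⊆ Ω) (hSb : Bornology.IsBounded S)
    (hSc : Convex ℝ S) {H : ℝ} (hH : Metric.diam S ≤ H) :
    volume.real S * (∫ y in S, u.toFun y ^ 2) - (∫ y in S, u.toFun y) ^ 2 ≤
      2 * H ^ 2 * halfPowIntegral d ^ 2 * volume.real S * ∫ y in S, ‖u.grad y‖ ^ 2 := by
  have hfin : IsFiniteMeasure (volume.restrict S) := ⟨by simpa using hSb.measure_lt_top⟩
  obtain ⟨φ, h1, h2, h3⟩ := u.exists_approx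
  have hle : volume.restrict S ≤ volume.restrict Ω := Measure.restrict_mono_set volume hS
  have hu := u.memLp_toFun.mono_measure hle
  have hg := u.memLp_grad.mono_measure hle
  have h2' : Tendsto (fun n => eLpNorm (fun x => φ n x - u.toFun x) 2 (volume.restrict S)) atTop
      (𝓝 0) := tendsto_of_tendsto_of_tendsto_of_le_of_le tendsto_const_nhds h2
        (fun _ => zero_le) fun n => eLpNorm_mono_measure _ hle
  have h3' : Tendsto (fun n => eLpNorm (fun x => gradient (φ n) x - u.grad x) 2
      (volume.restrict S)) atTop (𝓝 0) :=
    tendsto_of_tendsto_of_tendsto_of_le_of_le tendsto_const_nhds h3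
      (fun _ => zero_le) fun n => eLpNorm_mono_measure _ hle
  have l1 := tendsto_integral_norm_sq (fun n => (h1 n).memLp S) hu h2'
  have l2 := tendsto_integral_norm_sq (fun n => (h1 n).memLp_gradient S) hg h3'
  have l3 := tendsto_integral_of_L2 (fun n => (h1 n).memLp S) hu h2'
  simp only [Real.norm_eq_abs, sq_abs] at l1
  refine le_of_tendsto_of_tendsto' ((l1.const_mul _).sub (l3.pow 2)) (l2.const_mul _) fun n => ?_
  -- Cells need not be open, but the frontier of a convex set is null, so the smooth inequality on
  -- the interior suffices.
  have hae : interior S =ᵐ[volume] S :=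
    interior_ae_eq_of_null_frontier (hSc.addHaar_frontier volume)
  have hp := poincare_of_contDiff (u := φ n) ((h1 n).1.of_le (by simp)) (H := H) isOpen_interior
    (hSb.subset interior_subset) hSc.interior fun x hx y hy => by
      rw [← dist_eq_norm]
      exact (Metric.dist_le_diam_of_mem hSb (interior_subset hy) (interior_subset hx)).trans hH
  rwa [setIntegral_congr_set hae, setIntegral_congr_set hae, setIntegral_congr_set hae,
    measureReal_congr hae] at hp

/-- The truncated gauge `(θ - g)₊` of a convex set, with respect to the center `c`. -/
def gaugeBubble (S : Set E) (c : E) (θ : ℝ) (x : E) : ℝ :=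
  max (θ - gauge ((fun z => c + z) ⁻¹' S) (x - c)) 0

variable {S : Set (EuclideanSpace ℝ (Fin d))} {c : EuclideanSpace ℝ (Fin d)} {ρ θ : ℝ}

theorem ball_subset_preimage_add (hball : Metric.ball c ρ ⊆ S) :
    Metric.ball (0 : E) ρ ⊆ (fun z => c + z) ⁻¹' S := by
  intro z hz
  apply hball
  simpa using hz

/-- Sublevel sets of the gauge are homothetic copies of `S`, so their volumes are explicit. -/
theorem gauge_sub_lt_iff (hSo : IsOpen S) (hSc : Convex ℝ S) (hρ : 0 < ρ)
    (hball : Metric.ball c ρ ⊆ S) {s : ℝ} (hs : 0 < s) :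
    {x | gauge ((fun z => c + z) ⁻¹' S) (x - c) < s} = AffineMap.homothety c s '' S := by
  have hKo : IsOpen ((fun z => c + z) ⁻¹' S) := hSo.preimage (by fun_prop)
  have hKc : Convex ℝ ((fun z => c + z) ⁻¹' S) := hSc.translate_preimage_right c
  have hK0 : (0 : E) ∈ (fun z => c + z) ⁻¹' S :=
    ball_subset_preimage_add hball (Metric.mem_ball_self hρ)
  have hset := setOfPred_gauge_lt_one_eq_self_of_isOpen hKc hK0 hKo
  ext x
  have h1 : gauge ((fun z => c + z) ⁻¹' S) (x - c) < s ↔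
      gauge ((fun z => c + z) ⁻¹' S) (s⁻¹ • (x - c)) < 1 := by
    rw [gauge_smul_of_nonneg (inv_nonneg.2 hs.le), smul_eq_mul, inv_mul_lt_iff₀ hs, mul_one]
  have h2 : gauge ((fun z => c + z) ⁻¹' S) (s⁻¹ • (x - c)) < 1 ↔
      s⁻¹ • (x - c) ∈ (fun z => c + z) ⁻¹' S := by
    conv_rhs => rw [← hset]
    rfl
  rw [mem_ofPred_eq, h1, h2]
  constructor
  · intro h
    refine ⟨c + s⁻¹ • (x - c), h, ?_⟩
    simp [AffineMap.homothety_apply, hs.ne']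
  · rintro ⟨y, hy, rfl⟩
    simpa [AffineMap.homothety_apply, hs.ne'] using hy

theorem lipschitzWith_gaugeBubble (hSc : Convex ℝ S) (hρ : 0 < ρ) (hball : Metric.ball c ρ ⊆ S)
    (θ : ℝ) : LipschitzWith (Real.toNNReal ρ)⁻¹ (gaugeBubble S c θ) := by
  have h := (hSc.translate_preimage_right c).lipschitzWith_gauge
    (r := Real.toNNReal ρ) (by simpa using hρ)
    (by rw [Real.coe_toNNReal _ hρ.le]; exact ball_subset_preimage_add hball)
  have h2 : LipschitzWith (Real.toNNReal ρ)⁻¹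
      (fun x => θ - gauge ((fun z => c + z) ⁻¹' S) (x - c)) := by
    refine LipschitzWith.of_dist_le_mul fun x y => ?_
    have := h.dist_le_mul (x - c) (y - c)
    rwa [dist_sub_right, ← dist_sub_left θ] at this
  exact h2.max_const 0

/-- Truncating at a level `θ < 1` puts the closed set `{gauge ≤ θ}` inside the open set `S`. The
value `θ = 1` is reached only as a limit, in the multiplier bound. -/
theorem tsupport_gaugeBubble_subset (hSo : IsOpen S) (hSc : Convex ℝ S) (hρ : 0 < ρ)
    (hball : Metric.ball c ρ ⊆ S) (hθ : θ < 1) : tsupport (gaugeBubble S c θ) ⊆ S := by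
  have hcont : Continuous (gauge ((fun z => c + z) ⁻¹' S)) :=
    continuous_gauge (hSc.translate_preimage_right c)
      (mem_of_superset (Metric.ball_mem_nhds 0 hρ) (ball_subset_preimage_add hball))
  have hcl : IsClosed {x | gauge ((fun z => c + z) ⁻¹' S) (x - c) ≤ θ} :=
    isClosed_le (hcont.comp (by fun_prop)) continuous_const
  refine (closure_minimal (fun x hx => ?_) hcl).trans fun x hx => ?_
  · by_contra hx'
    rw [mem_ofPred_eq, not_le] at hx'
    exact hx (max_eq_right (by linarith))
  · have h1 : x ∈ {x | gauge ((fun z => c + z) ⁻¹' S) (x - c) < 1} := lt_of_le_of_lt hx hθ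
    rw [gauge_sub_lt_iff hSo hSc hρ hball one_pos] at h1
    simpa using h1

/-- Layer-cake formula: the level set above `t` is a copy of `S` scaled by `θ - t`, and `(θ - t)^d`
is integrated over `(0, θ)`. -/
theorem integral_gaugeBubble (hSo : IsOpen S) (hSb : Bornology.IsBounded S) (hSc : Convex ℝ S)
    (hρ : 0 < ρ) (hball : Metric.ball c ρ ⊆ S) (hθ0 : 0 < θ) (hθ : θ < 1) :
    ∫ x, gaugeBubble S c θ x = θ ^ (d + 1) / (d + 1) * volume.real S := by
  have hcs : HasCompactSupport (gaugeBubble S c θ) :=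
    hSb.isCompact_closure.of_isClosed_subset isClosed_closure
      ((tsupport_gaugeBubble_subset hSo hSc hρ hball hθ).trans subset_closure)
  have hint : Integrable (gaugeBubble S c θ) volume :=
    (lipschitzWith_gaugeBubble hSc hρ hball θ).continuous.integrable_of_hasCompactSupport hcs
  rw [hint.integral_eq_integral_meas_lt (Eventually.of_forall fun x => le_max_right _ _)]
  have hset : ∀ t ∈ Ioi (0 : ℝ), volume.real {x | t < gaugeBubble S c θ x} =
      (Ioo (0 : ℝ) θ).indicator (fun t => (θ - t) ^ d * volume.real S) t := by
    intro t ht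
    have hlevel : {x | t < gaugeBubble S c θ x} =
        {x | gauge ((fun z => c + z) ⁻¹' S) (x - c) < θ - t} := by
      ext x
      simp only [mem_ofPred_eq, gaugeBubble, lt_max_iff, not_lt.2 (le_of_lt (mem_Ioi.1 ht)),
        or_false]
      exact lt_sub_comm
    rw [hlevel]
    by_cases htθ : t < θ
    · rw [gauge_sub_lt_iff hSo hSc hρ hball (sub_pos.2 htθ), indicator_of_mem (show t ∈ Ioo 0 θ from ⟨ht, htθ⟩),
        measureReal_def, Measure.addHaar_image_homothety, ENNReal.toReal_mul,
        ENNReal.toReal_ofReal (abs_nonneg _), finrank_euclideanSpace_fin,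
        abs_of_nonneg (pow_nonneg (sub_pos.2 htθ).le d), measureReal_def]
    · rw [indicator_of_notMem fun h => htθ h.2]
      have : {x | gauge ((fun z => c + z) ⁻¹' S) (x - c) < θ - t} = ∅ :=
        eq_empty_of_forall_notMem fun x hx => by
          have h1 := gauge_nonneg (s := (fun z => c + z) ⁻¹' S) (x - c)
          have h2 : gauge ((fun z => c + z) ⁻¹' S) (x - c) < θ - t := hx
          linarith
      simp [this]
  rw [setIntegral_congr_fun measurableSet_Ioi hset, setIntegral_indicator measurableSet_Ioo,
    inter_eq_right.2 Ioo_subset_Ioi_self, integral_mul_const, ← integral_Ioc_eq_integral_Ioo,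
    ← intervalIntegral.integral_of_le hθ0.le]
  congr 1
  rw [intervalIntegral.integral_comp_sub_left (fun t => t ^ d)]
  simp

/-- A bump inside a convex cell with controlled gradient and mass. -/
theorem H10.exists_bubble (hΩo : IsOpen Ω) (hΩ : Bornology.IsBounded Ω) (hS : S ⊆ Ω)
    (hSc : Convex ℝ S) (hρ : 0 < ρ) (hball : Metric.ball c ρ ⊆ S) (hθ0 : 0 < θ) (hθ : θ < 1) :
    ∃ β : H10 Ω, (∀ x ∉ S, β.toFun x = 0) ∧ (∀ x ∉ S, β.grad x = 0) ∧
      (∀ x, ‖β.grad x‖ ≤ ρ⁻¹) ∧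
      ∫ x in S, β.toFun x = θ ^ (d + 1) / (d + 1) * volume.real S := by
  have hSb := hΩ.subset hS
  have hball' : Metric.ball c ρ ⊆ interior S := interior_maximal hball Metric.isOpen_ball
  have hlip := lipschitzWith_gaugeBubble hSc.interior hρ hball' θ
  have hsup := tsupport_gaugeBubble_subset isOpen_interior hSc.interior hρ hball' hθ
  have hint := integral_gaugeBubble isOpen_interior (hSb.subset interior_subset) hSc.interior hρ
    hball' hθ0 hθ
  have hae : interior S =ᵐ[volume] S :=
    interior_ae_eq_of_null_frontier (hSc.addHaar_frontier volume)
  rw [measureReal_congr hae] at hint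
  have hcs : HasCompactSupport (gaugeBubble (interior S) c θ) :=
    hSb.isCompact_closure.of_isClosed_subset isClosed_closure
      (hsup.trans (interior_subset.trans subset_closure))
  refine ⟨H10.ofLipschitz hΩo hΩ hlip hcs (hsup.trans (interior_subset.trans hS)), ?_, ?_, ?_, ?_⟩
  · exact fun x hx => image_eq_zero_of_notMem_tsupport fun h => hx (interior_subset (hsup h))
  · exact fun x hx => image_eq_zero_of_notMem_tsupport fun h =>
      hx (interior_subset (hsup (tsupport_gradient_subset _ h)))
  · intro x
    have := hlip.norm_gradient_le x
    rwa [NNReal.coe_inv, Real.coe_toNNReal _ hρ.le] at this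
  · rw [← hint]
    exact setIntegral_eq_integral_of_forall_compl_eq_zero fun x hx =>
      image_eq_zero_of_notMem_tsupport fun h => hx (interior_subset (hsup h))

end Cells

/-! ### Lagrange multipliers and their local bound. -/

section Multiplier

variable {d m : ℕ} {Ω : Set (EuclideanSpace ℝ (Fin d))}
  {a : EuclideanSpace ℝ (Fin d) → Matrix (Fin d) (Fin d) ℝ} {lmin lmax : ℝ}
  {τ : Fin m → Set (EuclideanSpace ℝ (Fin d))} {H δ : ℝ}

local notation "E" => EuclideanSpace ℝ (Fin d)

theorem IsCellPartition.setIntegral_eq_sum (hτ : IsCellPartition Ω τ H δ) {f : E → ℝ}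
    (hf : IntegrableOn f Ω volume) : ∫ x in Ω, f x = ∑ j, ∫ x in τ j, f x := by
  have hU : (⋃ j, τ j) =ᵐ[volume] Ω :=
    (iUnion_subset hτ.subset).eventuallyLE.antisymm
      (ae_le_set.2 hτ.cover)
  rw [← setIntegral_congr_set hU, integral_iUnion_ae hτ.nullMeasurableSet hτ.disjoint
    (hf.mono_set (iUnion_subset hτ.subset)), tsum_fintype]

theorem IsCellPartition.setIntegral_eq_zero (hτ : IsCellPartition Ω τ H δ) {j k : Fin m}
    (hjk : j ≠ k) {f : E → ℝ} (hf : ∀ x ∉ τ j, f x = 0) : ∫ x in τ k, f x = 0 := by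
  have h : ∀ᵐ x ∂(volume.restrict (τ k)), x ∉ τ j := by
    rw [← measure_eq_zero_iff_ae_notMem, Measure.restrict_apply₀' (hτ.nullMeasurableSet k)]
    exact hτ.disjoint hjk
  exact integral_eq_zero_of_ae (h.mono fun x hx => hf x hx)

/-- The linear functional `u ↦ ∫ (∇u)ᵀ a ∇ψ`. -/
def energyPairing (a : E → Matrix (Fin d) (Fin d) ℝ) (ψ u : H10 Ω) : ℝ :=
  ∫ x in Ω, matForm (a x) (u.grad x) (ψ.grad x)

theorem energyPairing_linComb (ha : IsUniformlyElliptic Ω a lmin lmax) (ψ u w : H10 Ω) (s : ℝ) :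
    energyPairing a ψ (u.linComb w s) = energyPairing a ψ u + s * energyPairing a ψ w := by
  simp only [energyPairing, H10.linComb, matForm_add_left, matForm_smul_left]
  rw [integral_add (ha.integrable u.memLp_grad ψ.memLp_grad)
    ((ha.integrable w.memLp_grad ψ.memLp_grad).const_mul s), integral_const_mul]

theorem H10.setIntegral_linComb (hΩ : Bornology.IsBounded Ω) (u w : H10 Ω) (s : ℝ) {S : Set E}
    (hS : S ⊆ Ω) : ∫ x in S, (u.linComb w s).toFun x =
      (∫ x in S, u.toFun x) + s * ∫ x in S, w.toFun x := by
  simp only [H10.linComb]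
  rw [integral_add (u.integrableOn hΩ hS) ((w.integrableOn hΩ hS).const_mul s),
    integral_const_mul]

/-- Used to correct the cell means of `v` by bubbles; only the pairing and the cell means of the sum
matter. -/
theorem H10.exists_sum (ha : IsUniformlyElliptic Ω a lmin lmax) (hΩ : Bornology.IsBounded Ω)
    (hτ : IsCellPartition Ω τ H δ) (ψ v : H10 Ω) (β : Fin m → H10 Ω) (c : Fin m → ℝ)
    (s : Finset (Fin m)) : ∃ w : H10 Ω,
      energyPairing a ψ w = energyPairing a ψ v + ∑ j ∈ s, c j * energyPairing a ψ (β j) ∧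
      ∀ k, ∫ x in τ k, w.toFun x =
        (∫ x in τ k, v.toFun x) + ∑ j ∈ s, c j * ∫ x in τ k, (β j).toFun x := by
  induction s using Finset.induction_on with
  | empty => exact ⟨v, by simp, by simp⟩
  | insert j s hj ih =>
    obtain ⟨w, h1, h2⟩ := ih
    refine ⟨w.linComb (β j) (c j), ?_, fun k => ?_⟩
    · rw [energyPairing_linComb ha, h1, Finset.sum_insert hj]
      ring
    · rw [H10.setIntegral_linComb hΩ _ _ _ (hτ.subset k), h2 k, Finset.sum_insert hj]
      ring

theorem IsUniformlyElliptic.memLp_sqrt (ha : IsUniformlyElliptic Ω a lmin lmax) (ψ : H10 Ω)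
    {S : Set E} (hS : S ⊆ Ω) :
    MemLp (fun x => √(matForm (a x) (ψ.grad x) (ψ.grad x))) 2 (volume.restrict S) ∧
      ∫ x in S, √(matForm (a x) (ψ.grad x) (ψ.grad x)) ^ 2 = energyOn a S ψ := by
  have hle : volume.restrict S ≤ volume.restrict Ω := Measure.restrict_mono_set volume hS
  have hi := (ha.integrable ψ.memLp_grad ψ.memLp_grad).mono_measure hle
  have hae : (fun x => √(matForm (a x) (ψ.grad x) (ψ.grad x)) ^ 2)
      =ᵐ[volume.restrict S] fun x => matForm (a x) (ψ.grad x) (ψ.grad x) := by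
    filter_upwards [ae_restrict_of_ae_restrict_of_subset hS ha.ae_nonneg] with x hx
    exact Real.sq_sqrt (hx _)
  refine ⟨?_, integral_congr_ae hae⟩
  rw [memLp_two_iff_integrable_sq
    (Real.continuous_sqrt.comp_aestronglyMeasurable hi.aestronglyMeasurable)]
  exact hi.congr hae.symm

/-- Since the gradient of `β` vanishes off `S`, Cauchy-Schwarz involves only the energy of `ψ` in
`S`. This locality makes the multiplier bounds cell by cell. -/
theorem abs_energyPairing_le (ha : IsUniformlyElliptic Ω a lmin lmax) (hΩo : IsOpen Ω)
    (hΩ : Bornology.IsBounded Ω) (ψ β : H10 Ω) {S : Set E} (hS : S ⊆ Ω) {K : ℝ}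
    (hβ : ∀ x ∉ S, β.grad x = 0) (hK : ∀ x, ‖β.grad x‖ ≤ K) :
    |energyPairing a ψ β| ≤ √lmax * K * (√(volume.real S) * √(energyOn a S ψ)) := by
  have hfin : IsFiniteMeasure (volume.restrict S) := ⟨by simpa using (hΩ.subset hS).measure_lt_top⟩
  obtain ⟨hm, hE⟩ := ha.memLp_sqrt ψ hS
  have h1 : energyPairing a ψ β = ∫ x in S, matForm (a x) (β.grad x) (ψ.grad x) := by
    refine (setIntegral_eq_of_subset_of_forall_sdiff_eq_zero hΩo.measurableSet hS
      fun x hx => ?_)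
    simp [hβ x hx.2, matForm]
  have hc := abs_integral_mul_le (memLp_const (1 : ℝ)) hm
  rw [hE] at hc
  simp only [one_mul, one_pow, setIntegral_const, smul_eq_mul, mul_one] at hc
  have hK0 : 0 ≤ K := (norm_nonneg _).trans (hK 0)
  calc |energyPairing a ψ β|
      ≤ ∫ x in S, √lmax * K * √(matForm (a x) (ψ.grad x) (ψ.grad x)) := by
        rw [h1, ← Real.norm_eq_abs]
        refine norm_integral_le_of_norm_le ((hm.integrable one_le_two).const_mul _) ?_
        filter_upwards [ae_restrict_of_ae_restrict_of_subset hS ha.ae_abs_le] with x hx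
        refine (hx _ _).trans ?_
        have := hK x
        gcongr
    _ = √lmax * K * ∫ x in S, √(matForm (a x) (ψ.grad x) (ψ.grad x)) := integral_const_mul _ _
    _ ≤ _ := mul_le_mul_of_nonneg_left ((le_abs_self _).trans hc) (by positivity)

theorem IsCellPartition.measureReal_pos (hΩ : Bornology.IsBounded Ω)
    (hτ : IsCellPartition Ω τ H δ) (hH : 0 < H) (hδ : 0 < δ) (j : Fin m) :
    0 < volume.real (τ j) := by
  obtain ⟨c, hc⟩ := hτ.exists_ball j
  have h1 : 0 < volume (τ j) :=
    (Metric.measure_ball_pos volume c (by positivity)).trans_le (measure_mono hc)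
  exact ENNReal.toReal_pos h1.ne' (hΩ.subset (hτ.subset j)).measure_lt_top.ne

/-- Lagrange multipliers for the constraints, with a bound from testing against bumps. -/
theorem exists_multiplier (ha : IsUniformlyElliptic Ω a lmin lmax) (hΩo : IsOpen Ω)
    (hΩ : Bornology.IsBounded Ω) (hτ : IsCellPartition Ω τ H δ) (hH : 0 < H) (hδ : 0 < δ)
    {ψ : H10 Ω}
    (hEL : ∀ w : H10 Ω, (∀ j, ∫ x in τ j, w.toFun x = 0) → energyPairing a ψ w = 0) :
    ∃ l : Fin m → ℝ, (∀ v : H10 Ω, energyPairing a ψ v = ∑ j, l j * ∫ x in τ j, v.toFun x) ∧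
      ∀ j, |l j| * √(volume.real (τ j)) ≤
        √lmax * ((d + 1) * (2 / (δ * H))) * √(energyOn a (τ j) ψ) := by
  have hρ : 0 < δ * H / 2 := by positivity
  have hex : ∀ θ : ℝ, 0 < θ → θ < 1 → ∀ j, ∃ β : H10 Ω, (∀ x ∉ τ j, β.toFun x = 0) ∧
      (∀ x ∉ τ j, β.grad x = 0) ∧ (∀ x, ‖β.grad x‖ ≤ (δ * H / 2)⁻¹) ∧
      ∫ x in τ j, β.toFun x = θ ^ (d + 1) / (d + 1) * volume.real (τ j) := by
    intro θ h0 h1 j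
    obtain ⟨c, hc⟩ := hτ.exists_ball j
    exact H10.exists_bubble hΩo hΩ (hτ.subset j) (hτ.convex j) hρ hc h0 h1
  -- Any fixed bubble with nonzero mass in each cell defines the multipliers; the level `1/2` is
  -- arbitrary.
  choose β hβ0 hβ1 hβ2 hβ3 using hex (1 / 2) (by norm_num) (by norm_num)
  have hpos := hτ.measureReal_pos hΩ hH hδ
  have hM : ∀ j, 0 < ∫ x in τ j, (β j).toFun x := fun j => by
    rw [hβ3]; have := hpos j; positivity
  set l : Fin m → ℝ := fun j => energyPairing a ψ (β j) / ∫ x in τ j, (β j).toFun x with hl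
  have hrep : ∀ v : H10 Ω, energyPairing a ψ v = ∑ j, l j * ∫ x in τ j, v.toFun x := by
    intro v
    obtain ⟨w, hw1, hw2⟩ := H10.exists_sum ha hΩ hτ ψ v β
      -- These coefficients cancel every cell mean of `v`, which makes the sum a legal test function
      -- for `hEL`.
      (fun j => -(∫ x in τ j, v.toFun x) / ∫ x in τ j, (β j).toFun x) Finset.univ
    have hw0 := hEL w fun k => by
      rw [hw2 k, Finset.sum_eq_single k]
      · have := (hM k).ne'
        field_simp
        ring
      · intro j _ hjk
        rw [hτ.setIntegral_eq_zero hjk (hβ0 j), mul_zero]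
      · simp
    rw [hw1] at hw0
    rw [eq_neg_of_add_eq_zero_left hw0, ← Finset.sum_neg_distrib]
    refine Finset.sum_congr rfl fun j _ => ?_
    simp only [hl]
    ring
  refine ⟨l, hrep, fun j => ?_⟩
  set s := √(volume.real (τ j)) with hs
  have hs0 : 0 < s := Real.sqrt_pos.2 (hpos j)
  have hss : volume.real (τ j) = s * s := (Real.mul_self_sqrt (hpos j).le).symm
  -- The multipliers do not depend on the bubble, so the representation may be tested with any level
  -- `θ`. The factor `θ^(d+1)` disappears as `θ → 1`.
  have hθ : ∀ θ : ℝ, 0 < θ → θ < 1 → θ ^ (d + 1) * (|l j| * s) ≤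
      √lmax * ((d + 1) * (2 / (δ * H))) * √(energyOn a (τ j) ψ) := by
    intro θ h0 h1
    obtain ⟨χ, h2, h3, h4, h5⟩ := hex θ h0 h1 j
    have h6 := abs_energyPairing_le ha hΩo hΩ ψ χ (hτ.subset j) h3 h4
    rw [hrep χ, Finset.sum_eq_single j, h5, ← hs, hss, abs_mul] at h6
    · rw [abs_of_nonneg (by positivity : (0 : ℝ) ≤ θ ^ (d + 1) / (d + 1) * (s * s))] at h6
      have h7 : |l j| * (θ ^ (d + 1) / (d + 1) * (s * s)) =
          (θ ^ (d + 1) * (|l j| * s)) * (s / (d + 1)) := by field_simp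
      have h8 : √lmax * (δ * H / 2)⁻¹ * (s * √(energyOn a (τ j) ψ)) =
          (√lmax * ((d + 1) * (2 / (δ * H))) * √(energyOn a (τ j) ψ)) * (s / (d + 1)) := by
        field_simp
      rw [h7, h8] at h6
      exact le_of_mul_le_mul_right h6 (by positivity)
    · intro k _ hkj
      rw [hτ.setIntegral_eq_zero hkj.symm h2, mul_zero]
    · simp
  have hlim : Tendsto (fun θ : ℝ => θ ^ (d + 1) * (|l j| * s)) (𝓝[<] 1)
      (𝓝 (1 ^ (d + 1) * (|l j| * s))) :=
    (((continuous_pow (d + 1)).tendsto (1 : ℝ)).mul_const _).mono_left nhdsWithin_le_nhds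
  rw [one_pow, one_mul] at hlim
  refine le_of_tendsto hlim ?_
  filter_upwards [Ioo_mem_nhdsLT (zero_lt_one (α := ℝ))] with θ hθ'
  exact hθ θ hθ'.1 hθ'.2

end Multiplier

/-! ### The energy estimate across a shell of cells. -/

section Shell

variable {d m : ℕ} {Ω : Set (EuclideanSpace ℝ (Fin d))}
  {a : EuclideanSpace ℝ (Fin d) → Matrix (Fin d) (Fin d) ℝ} {lmin lmax : ℝ}
  {τ : Fin m → Set (EuclideanSpace ℝ (Fin d))} {H δ : ℝ}

local notation "E" => EuclideanSpace ℝ (Fin d)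

/-- On a bounded set, a Lipschitz function stays within half its oscillation of some value. -/
theorem LipschitzWith.exists_abs_sub_le_half {f : E → ℝ} {C : ℝ≥0} (hf : LipschitzWith C f)
    {S : Set E} (hS : S.Nonempty) (hSb : Bornology.IsBounded S) (hH : Metric.diam S ≤ H) :
    ∃ e, ∀ y ∈ S, |f y - e| ≤ C * H / 2 := by
  have hosc : ∀ y ∈ S, ∀ z ∈ S, f y ≤ f z + C * H := by
    intro y hy z hz
    have h1 := hf.dist_le_mul y z
    rw [Real.dist_eq] at h1
    have h2 : (C : ℝ) * dist y z ≤ C * H :=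
      mul_le_mul_of_nonneg_left ((Metric.dist_le_diam_of_mem hSb hy hz).trans hH) C.2
    linarith [le_abs_self (f y - f z)]
  obtain ⟨z0, hz0⟩ := hS
  have hne : (f '' S).Nonempty := ⟨f z0, z0, hz0, rfl⟩
  have hA : BddAbove (f '' S) := ⟨f z0 + C * H, by rintro _ ⟨y, hy, rfl⟩; exact hosc y hy z0 hz0⟩
  have hB : BddBelow (f '' S) :=
    ⟨f z0 - C * H, by rintro _ ⟨y, hy, rfl⟩; linarith [hosc z0 hz0 y hy]⟩
  have h1 : sSup (f '' S) - C * H ≤ sInf (f '' S) := by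
    refine le_csInf hne ?_
    rintro _ ⟨z, hz, rfl⟩
    have : sSup (f '' S) ≤ f z + C * H := csSup_le hne (by
      rintro _ ⟨y, hy, rfl⟩; exact hosc y hy z hz)
    linarith
  -- The middle of the range, rather than a value of `f`, gains the factor `1/2`.
  refine ⟨(sInf (f '' S) + sSup (f '' S)) / 2, fun y hy => abs_le.2 ⟨?_, ?_⟩⟩
  · have := csInf_le hB (mem_image_of_mem f hy)
    linarith
  · have := le_csSup hA (mem_image_of_mem f hy)
    linarith

theorem ae_gradient_eq_zero_of_const {S : Set E} (hSc : Convex ℝ S) {η : E → ℝ} {k : ℝ}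
    (hη : ∀ y ∈ S, η y = k) : ∀ᵐ y ∂(volume.restrict S), gradient η y = 0 := by
  have hae : interior S =ᵐ[volume] S :=
    interior_ae_eq_of_null_frontier (hSc.addHaar_frontier volume)
  rw [← Measure.restrict_congr_set hae]
  filter_upwards [ae_restrict_mem isOpen_interior.measurableSet] with y hy
  have h1 : η =ᶠ[𝓝 y] fun _ => k := by
    filter_upwards [isOpen_interior.mem_nhds hy] with z hz using hη z (interior_subset hz)
  simp [gradient, h1.fderiv_eq]

theorem H10.sqrt_integral_sq_le (ha : IsUniformlyElliptic Ω a lmin lmax)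
    (hΩ : Bornology.IsBounded Ω) (hτ : IsCellPartition Ω τ H δ) (hH : 0 < H) (hδ : 0 < δ)
    (ψ : H10 Ω) {j : Fin m} (hmean : ∫ x in τ j, ψ.toFun x = 0) :
    √(∫ x in τ j, ψ.toFun x ^ 2) ≤
      √2 * H * halfPowIntegral d / √lmin * √(energyOn a (τ j) ψ) := by
  have hS := hτ.subset j
  have hpos := hτ.measureReal_pos hΩ hH hδ j
  have hp := ψ.poincare hS (hΩ.subset hS) (hτ.convex j) (hτ.diam_le j)
  have hle : volume.restrict (τ j) ≤ volume.restrict Ω := Measure.restrict_mono_set volume hS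
  have hJ := halfPowIntegral_pos d
  have hE : lmin * ∫ x in τ j, ‖ψ.grad x‖ ^ 2 ≤ energyOn a (τ j) ψ := by
    rw [← integral_const_mul, energyOn_eq]
    refine integral_mono_ae ((ψ.memLp_grad.mono_measure hle).norm.integrable_sq.const_mul _)
      ((ha.integrable ψ.memLp_grad ψ.memLp_grad).mono_measure hle) ?_
    filter_upwards [ae_restrict_of_ae_restrict_of_subset hS ha.lower] with x hx using hx _
  rw [hmean] at hp
  have h1 : ∫ x in τ j, ψ.toFun x ^ 2 ≤
      2 * H ^ 2 * halfPowIntegral d ^ 2 * ∫ x in τ j, ‖ψ.grad x‖ ^ 2 := by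
    refine le_of_mul_le_mul_left ?_ hpos
    linarith
  have hlm := ha.lmin_pos
  have h2 : ∫ x in τ j, ‖ψ.grad x‖ ^ 2 ≤ energyOn a (τ j) ψ / lmin := by
    rw [le_div_iff₀ hlm]; linarith
  have hE0 := energyOn_nonneg ha hS ψ
  refine Real.sqrt_le_iff.2 ⟨by positivity, h1.trans ?_⟩
  rw [mul_pow, div_pow, mul_pow, mul_pow, Real.sq_sqrt hlm.le, Real.sq_sqrt hE0,
    Real.sq_sqrt zero_le_two]
  calc _ ≤ 2 * H ^ 2 * halfPowIntegral d ^ 2 * (energyOn a (τ j) ψ / lmin) := by gcongr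
    _ = _ := by ring

/-- The constant of the energy estimate in a shell. -/
def shellConst (d : ℕ) (lmin lmax δ : ℝ) : ℝ :=
  √(lmax / lmin) * (√2 * halfPowIntegral d * (1 + (d + 1) / δ))

theorem IsCellPartition.nonempty (hτ : IsCellPartition Ω τ H δ) (hH : 0 < H) (hδ : 0 < δ)
    (j : Fin m) : (τ j).Nonempty := by
  obtain ⟨c, hc⟩ := hτ.exists_ball j
  exact ⟨c, hc (Metric.mem_ball_self (by positivity))⟩

/-- As `ψ` has zero mean on the cell, a constant can be subtracted from `η`, so only its oscillation
counts. The factor `H` gained here cancels the `1/H` in the multiplier bound. -/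
theorem abs_setIntegral_lipschitz_mul_le (hΩ : Bornology.IsBounded Ω)
    (hτ : IsCellPartition Ω τ H δ) (hH : 0 < H) (hδ : 0 < δ) (ψ : H10 Ω) {j : Fin m}
    (hmean : ∫ x in τ j, ψ.toFun x = 0) {η : E → ℝ} {C : ℝ≥0} (hη : LipschitzWith C η)
    (hη1 : ∀ x, |η x| ≤ 1) :
    |∫ x in τ j, η x * ψ.toFun x| ≤
      C * H / 2 * (√(volume.real (τ j)) * √(∫ x in τ j, ψ.toFun x ^ 2)) := by
  have hS := hτ.subset j
  have hfin : IsFiniteMeasure (volume.restrict (τ j)) :=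
    ⟨by simpa using (hΩ.subset hS).measure_lt_top⟩
  have hle : volume.restrict (τ j) ≤ volume.restrict Ω := Measure.restrict_mono_set volume hS
  have hψ := ψ.memLp_toFun.mono_measure hle
  have hψi := hψ.integrable one_le_two
  obtain ⟨e, he⟩ := hη.exists_abs_sub_le_half (hτ.nonempty hH hδ j) (hΩ.subset hS) (hτ.diam_le j)
  have hηψ : Integrable (fun x => η x * ψ.toFun x) (volume.restrict (τ j)) :=
    hψi.mono (hη.continuous.aestronglyMeasurable.mul hψi.1) (Eventually.of_forall fun x => by
      rw [norm_mul]; exact mul_le_of_le_one_left (norm_nonneg _) (hη1 x))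
  have h1 : ∫ x in τ j, η x * ψ.toFun x = ∫ x in τ j, (η x - e) * ψ.toFun x := by
    simp only [sub_mul]
    rw [integral_sub hηψ (hψi.const_mul e), integral_const_mul, hmean, mul_zero, sub_zero]
  have hc := abs_integral_mul_le (memLp_const (1 : ℝ)) hψ.norm
  simp only [one_mul, one_pow, setIntegral_const, smul_eq_mul, mul_one, Real.norm_eq_abs,
    sq_abs] at hc
  calc |∫ x in τ j, η x * ψ.toFun x| ≤ ∫ x in τ j, C * H / 2 * |ψ.toFun x| := by
        rw [h1, ← Real.norm_eq_abs]
        refine norm_integral_le_of_norm_le (hψi.norm.const_mul _) ?_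
        have hmem : ∀ᵐ x ∂(volume.restrict (τ j)), x ∈ τ j :=
          ae_restrict_mem₀ (hτ.nullMeasurableSet j)
        filter_upwards [hmem] with x hx
        rw [norm_mul, Real.norm_eq_abs, Real.norm_eq_abs]
        exact mul_le_mul_of_nonneg_right (he x hx) (abs_nonneg _)
    _ = C * H / 2 * ∫ x in τ j, |ψ.toFun x| := integral_const_mul _ _
    _ ≤ _ := mul_le_mul_of_nonneg_left ((le_abs_self _).trans hc) (by positivity)

/-- The product rule gives `η ∇ψᵀ a ∇ψ`, which is nonnegative and dropped, plus the term with `ψ∇η`,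
estimated by Cauchy-Schwarz. -/
theorem neg_le_setIntegral_matForm (ha : IsUniformlyElliptic Ω a lmin lmax) (ψ w : H10 Ω)
    {η : E → ℝ} {C : ℝ≥0} (hη : LipschitzWith C η) (hη0 : ∀ x, 0 ≤ η x)
    (hw : w.grad = fun x => η x • ψ.grad x + ψ.toFun x • gradient η x) {S : Set E} (hS : S ⊆ Ω) :
    -(C * √lmax * (√(∫ x in S, ψ.toFun x ^ 2) * √(energyOn a S ψ))) ≤
      ∫ x in S, matForm (a x) (w.grad x) (ψ.grad x) := by
  have hle : volume.restrict S ≤ volume.restrict Ω := Measure.restrict_mono_set volume hS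
  obtain ⟨hm, hE⟩ := ha.memLp_sqrt ψ hS
  have hψ := ψ.memLp_toFun.mono_measure hle
  have hc := abs_integral_mul_le hψ.norm hm
  rw [hE] at hc
  simp only [Real.norm_eq_abs, sq_abs] at hc
  have hi : Integrable (fun x => |ψ.toFun x| * √(matForm (a x) (ψ.grad x) (ψ.grad x)))
      (volume.restrict S) := hψ.norm.integrable_mul hm
  calc _ ≤ -(C * √lmax * ∫ x in S, |ψ.toFun x| * √(matForm (a x) (ψ.grad x) (ψ.grad x))) :=
        neg_le_neg (mul_le_mul_of_nonneg_left ((le_abs_self _).trans hc) (by positivity))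
    _ = ∫ x in S, -(C * √lmax * (|ψ.toFun x| * √(matForm (a x) (ψ.grad x) (ψ.grad x)))) := by
        rw [integral_neg, integral_const_mul]
    _ ≤ _ := by
        refine integral_mono_ae (hi.const_mul _).neg
          ((ha.integrable w.memLp_grad ψ.memLp_grad).mono_measure hle) ?_
        filter_upwards [ae_restrict_of_ae_restrict_of_subset hS ha.ae_abs_le,
          ae_restrict_of_ae_restrict_of_subset hS ha.ae_nonneg] with x hx hx0
        simp only [hw]
        rw [matForm_add_left, matForm_smul_left, matForm_smul_left]
        have h1 := mul_nonneg (hη0 x) (hx0 (ψ.grad x))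
        have h2 : |ψ.toFun x * matForm (a x) (gradient η x) (ψ.grad x)| ≤
            C * √lmax * (|ψ.toFun x| * √(matForm (a x) (ψ.grad x) (ψ.grad x))) := by
          rw [abs_mul]
          have h3 := hη.norm_gradient_le x
          calc _ ≤ |ψ.toFun x| * (√lmax * C * √(matForm (a x) (ψ.grad x) (ψ.grad x))) :=
                mul_le_mul_of_nonneg_left ((hx _ _).trans (by gcongr)) (abs_nonneg _)
            _ = _ := by ring
        linarith [neg_abs_le (ψ.toFun x * matForm (a x) (gradient η x) (ψ.grad x))]

/-- The representation by multipliers, tested with `ηψ`, says that the cell contributions `t j` sum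
to zero. Those of `O` are full energies, those outside `O ∪ T` vanish, and those of `T` can only be
negative up to a multiple of the local energy. -/
theorem sum_energyOn_le (ha : IsUniformlyElliptic Ω a lmin lmax) (hΩo : IsOpen Ω)
    (hΩ : Bornology.IsBounded Ω) (hτ : IsCellPartition Ω τ H δ) (hH : 0 < H) (hδ : 0 < δ)
    {ψ : H10 Ω}
    (hEL : ∀ w : H10 Ω, (∀ j, ∫ x in τ j, w.toFun x = 0) → energyPairing a ψ w = 0)
    {i : Fin m} (hmean : ∀ j, j ≠ i → ∫ x in τ j, ψ.toFun x = 0)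
    {η : E → ℝ} {C : ℝ≥0} (hη : LipschitzWith C η) (hη0 : ∀ x, 0 ≤ η x) (hη1 : ∀ x, η x ≤ 1)
    (hηi : ∀ x ∈ τ i, η x = 0) {O T : Finset (Fin m)} (hOT : Disjoint O T)
    (hO : ∀ j ∈ O, ∀ x ∈ τ j, η x = 1) (hrest : ∀ j, j ∉ O → j ∉ T → ∀ x ∈ τ j, η x = 0) :
    ∑ j ∈ O, energyOn a (τ j) ψ ≤
      C * H * shellConst d lmin lmax δ * ∑ j ∈ T, energyOn a (τ j) ψ := by
  have hηabs : ∀ x, |η x| ≤ 1 := fun x => abs_le.2 ⟨by linarith [hη0 x], hη1 x⟩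
  obtain ⟨w, hw, hw'⟩ := ψ.exists_mul hΩo hΩ hη hηabs
  obtain ⟨l, hl, hlb⟩ := exists_multiplier ha hΩo hΩ hτ hH hδ hEL
  set t : Fin m → ℝ := fun j => (∫ x in τ j, matForm (a x) (w.grad x) (ψ.grad x)) -
    l j * ∫ x in τ j, w.toFun x with ht
  have hsum : ∑ j, t j = 0 := by
    simp only [ht]
    rw [Finset.sum_sub_distrib, ← hl w, energyPairing,
      hτ.setIntegral_eq_sum (ha.integrable w.memLp_grad ψ.memLp_grad), sub_self]
  have hconst : ∀ j k, (∀ x ∈ τ j, η x = k) → t j =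
      k * energyOn a (τ j) ψ - l j * (k * ∫ x in τ j, ψ.toFun x) := by
    intro j k hk
    have hmem : ∀ᵐ x ∂(volume.restrict (τ j)), x ∈ τ j :=
      ae_restrict_mem₀ (hτ.nullMeasurableSet j)
    have e1 : ∫ x in τ j, matForm (a x) (w.grad x) (ψ.grad x) =
        ∫ x in τ j, k * matForm (a x) (ψ.grad x) (ψ.grad x) := by
      refine integral_congr_ae ?_
      filter_upwards [hmem, ae_gradient_eq_zero_of_const (hτ.convex j) hk] with x hx hx'
      simp only [hw', hx', smul_zero, add_zero, hk x hx, matForm_smul_left]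
    have e2 : ∫ x in τ j, w.toFun x = ∫ x in τ j, k * ψ.toFun x := by
      refine integral_congr_ae ?_
      filter_upwards [hmem] with x hx
      simp only [hw, hk x hx]
    simp only [ht]
    rw [e1, e2, integral_const_mul, integral_const_mul, energyOn_eq]
  set B := C * H * shellConst d lmin lmax δ with hB
  have hJ := halfPowIntegral_pos d
  have hB0 : 0 ≤ B := by rw [hB, shellConst]; positivity
  have hT : ∀ j, -(B * energyOn a (τ j) ψ) ≤ t j := by
    intro j
    have hE0 := energyOn_nonneg ha (hτ.subset j) ψ
    -- Cell `i` is the only one where the mean of `ψ` may be nonzero, so Poincaré is not available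
    -- there; but `η` vanishes on it.
    by_cases hji : j = i
    · subst hji
      rw [hconst j 0 hηi]
      have := mul_nonneg hB0 hE0
      linarith
    · have h1 := neg_le_setIntegral_matForm ha ψ w hη hη0 hw' (hτ.subset j)
      have h2 := abs_setIntegral_lipschitz_mul_le hΩ hτ hH hδ ψ (hmean j hji) hη hηabs
      have h3 := ψ.sqrt_integral_sq_le ha hΩ hτ hH hδ (hmean j hji)
      have h4 := hlb j
      simp only [ht, hw]
      set N := √(∫ x in τ j, ψ.toFun x ^ 2)
      set e := √(energyOn a (τ j) ψ) with he
      set s := √(volume.real (τ j))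
      have hee : energyOn a (τ j) ψ = e * e := (Real.mul_self_sqrt hE0).symm
      have h5 : |l j * ∫ x in τ j, η x * ψ.toFun x| ≤
          √lmax * ((d + 1) * (2 / (δ * H))) * e * (C * H / 2 * N) := by
        rw [abs_mul]
        calc _ ≤ |l j| * (C * H / 2 * (s * N)) := mul_le_mul_of_nonneg_left h2 (abs_nonneg _)
          _ = (|l j| * s) * (C * H / 2 * N) := by ring
          _ ≤ _ := mul_le_mul_of_nonneg_right h4 (by positivity)
      -- In `1 + (d + 1)/δ` the `1` comes from `ψ∇η` and `(d + 1)/δ` from the multiplier.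
      have h6 : C * √lmax * (N * e) + √lmax * ((d + 1) * (2 / (δ * H))) * e * (C * H / 2 * N) =
          C * √lmax * e * (1 + (d + 1) / δ) * N := by
        field_simp
      have h7 : C * √lmax * e * (1 + (d + 1) / δ) * N ≤
          C * √lmax * e * (1 + (d + 1) / δ) * (√2 * H * halfPowIntegral d / √lmin * e) :=
        mul_le_mul_of_nonneg_left h3 (by positivity)
      have h8 : C * √lmax * e * (1 + (d + 1) / δ) * (√2 * H * halfPowIntegral d / √lmin * e) =
          B * energyOn a (τ j) ψ := by
        rw [hee, hB, shellConst, Real.sqrt_div' _ ha.lmin_pos.le]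
        ring
      linarith [le_abs_self (l j * ∫ x in τ j, η x * ψ.toFun x)]
  have hOval : ∀ j ∈ O, t j = energyOn a (τ j) ψ := by
    intro j hj
    have hji : j ≠ i := by
      rintro rfl
      obtain ⟨x, hx⟩ := hτ.nonempty hH hδ j
      have := hO j hj x hx
      rw [hηi x hx] at this
      exact zero_ne_one this
    rw [hconst j 1 (hO j hj), hmean j hji]
    ring
  have hsplit : ∑ j ∈ O, t j + ∑ j ∈ T, t j = 0 := by
    rw [← Finset.sum_union hOT, ← hsum]
    refine Finset.sum_subset (Finset.subset_univ _) fun j _ hj => ?_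
    rw [Finset.mem_union, not_or] at hj
    rw [hconst j 0 (hrest j hj.1 hj.2)]
    ring
  rw [Finset.sum_congr rfl hOval] at hsplit
  have hTsum : ∑ j ∈ T, -(B * energyOn a (τ j) ψ) ≤ ∑ j ∈ T, t j :=
    Finset.sum_le_sum fun j _ => hT j
  rw [Finset.sum_neg_distrib, ← Finset.mul_sum] at hTsum
  linarith

end Shell

/-! ### Numerical comparison of the constants. -/

section Constants

theorem halfPowIntegral_two : halfPowIntegral 2 = Real.log 2 := by
  have h : ∀ t : ℝ, t ^ (-(((2 : ℕ) : ℝ) / 2)) = t⁻¹ := fun t => by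
    rw [show -(((2 : ℕ) : ℝ) / 2) = -1 by norm_num, Real.rpow_neg_one]
  simp only [halfPowIntegral, h]
  rw [integral_inv_of_pos (by norm_num) one_pos]
  norm_num

theorem halfPowIntegral_eq {d : ℕ} (hd : d ≠ 2) :
    halfPowIntegral d = ((2 : ℝ) ^ ((d : ℝ) / 2) - 2) / (d - 2) := by
  have h2 : (d : ℝ) - 2 ≠ 0 := by
    rw [sub_ne_zero]; exact_mod_cast hd
  have h3 : -((d : ℝ) / 2) + 1 ≠ 0 := fun h => h2 (by linarith)
  rw [halfPowIntegral, integral_rpow (Or.inr ⟨fun h => h3 (by linarith), by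
    rw [uIcc_of_le (by norm_num)]; exact fun h => by linarith [h.1]⟩)]
  rw [Real.one_rpow, one_div, Real.inv_rpow zero_le_two, ← Real.rpow_neg zero_le_two,
    show -(-((d : ℝ) / 2) + 1) = (d : ℝ) / 2 - 1 by ring, Real.rpow_sub_one two_ne_zero]
  rw [div_eq_div_iff h3 h2]
  ring

theorem halfPowIntegral_le {d : ℕ} (hd : 0 < d) :
    (d + 2) * halfPowIntegral d ≤ 8 / 5 * (2 : ℝ) ^ ((d : ℝ) / 2) := by
  have hX0 : 0 < (2 : ℝ) ^ ((d : ℝ) / 2) := Real.rpow_pos_of_pos two_pos _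
  have hX2 : ((2 : ℝ) ^ ((d : ℝ) / 2)) ^ 2 = 2 ^ d := by
    rw [← Real.rpow_natCast, ← Real.rpow_mul zero_le_two, ← Real.rpow_natCast]
    congr 1
    push_cast
    ring
  by_cases h2 : d = 2
  · subst h2
    rw [halfPowIntegral_two]
    have := Real.log_two_lt_d9
    norm_num
    linarith
  rw [halfPowIntegral_eq h2]
  set X := (2 : ℝ) ^ ((d : ℝ) / 2) with hX
  have hsqrt : ∀ b : ℝ, 0 ≤ b → (2 : ℝ) ^ d ≤ b ^ 2 → X ≤ b := fun b hb h =>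
    le_of_sq_le_sq (hX2.trans_le h) hb
  rcases Nat.lt_or_ge d 3 with h3 | h3
  · have h1 : d = 1 := by omega
    subst h1
    have hlow : 7 / 5 ≤ X := le_of_sq_le_sq (by rw [hX2]; norm_num) hX0.le
    norm_num
    linarith
  have h3' : (3 : ℝ) ≤ d := by exact_mod_cast h3
  rw [mul_div_assoc', div_le_iff₀ (by linarith)]
  -- The bracket is negative from `d = 9` on. Below that, `2^(d/2)` is replaced by a rational upper
  -- bound.
  suffices X * (26 / 5 - 3 / 5 * d) ≤ 2 * (d + 2) by nlinarith
  rcases Nat.lt_or_ge d 9 with h9 | h9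
  · interval_cases d
    · have := hsqrt (283 / 100) (by norm_num) (by norm_num); norm_num; linarith
    · have := hsqrt 4 (by norm_num) (by norm_num); norm_num; linarith
    · have := hsqrt (57 / 10) (by norm_num) (by norm_num); norm_num; linarith
    · have := hsqrt 8 (by norm_num) (by norm_num); norm_num; linarith
    · have := hsqrt 12 (by norm_num) (by norm_num); norm_num; linarith
    · have := hsqrt 16 (by norm_num) (by norm_num); norm_num; linarith
  · have h9' : (9 : ℝ) ≤ d := by exact_mod_cast h9
    nlinarith

/-- The shell constant is small compared with the decay length. -/
theorem shellConst_mul_le {d : ℕ} (hd : 0 < d) {lmin lmax δ : ℝ} (hlmin : 0 < lmin)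
    (hle : lmin ≤ lmax) (hδ0 : 0 < δ) (hδ1 : δ < 1) :
    shellConst d lmin lmax δ * (Real.exp 1 - 1) ≤ decayLength d lmin lmax δ - 2 := by
  have hJ := halfPowIntegral_pos d
  have hJ2 := halfPowIntegral_le hd
  set J := halfPowIntegral d
  set X := (2 : ℝ) ^ ((d : ℝ) / 2) with hX
  set D := 2 / δ with hD
  have hD2 : 2 ≤ D := by rw [hD, le_div_iff₀ hδ0]; linarith
  have hX1 : 1 ≤ X := Real.one_le_rpow one_le_two (by positivity)
  have hd0 : (0 : ℝ) < d := by exact_mod_cast hd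
  set s := √(lmax / lmin) with hs
  have hs1 : 1 ≤ s := Real.one_le_sqrt.2 ((one_le_div hlmin).2 hle)
  have hδD : ((d : ℝ) + 1) / δ = (d + 1) * (D / 2) := by rw [hD]; field_simp
  have hr2 : (2 : ℝ) ^ (3 / 2 : ℝ) = 2 * √2 := by
    rw [show (3 / 2 : ℝ) = 1 + 1 / 2 by norm_num, Real.rpow_add two_pos, Real.rpow_one,
      ← Real.sqrt_eq_rpow]
  -- Because `D = 2/δ ≥ 2`, the power in the decay length absorbs the growth `2^(d/2)` of the
  -- Poincaré constant.
  have hDX : D * X ≤ D ^ (1 + (d : ℝ) / 2) := by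
    rw [Real.rpow_add (by linarith), Real.rpow_one]
    exact mul_le_mul_of_nonneg_left (Real.rpow_le_rpow zero_le_two hD2 (by positivity))
      (by linarith)
  set P := D ^ (1 + (d : ℝ) / 2) with hP
  have he1 := Real.exp_one_gt_d9
  have he2 := Real.exp_one_lt_d9
  have hpi := Real.pi_lt_d4
  have hpi0 := Real.pi_pos
  have hq : (86 / 100 : ℝ) ≤ Real.exp 1 / Real.pi := by
    rw [le_div_iff₀ hpi0]; linarith
  have hr : 1 ≤ √2 := Real.one_le_sqrt.2 one_le_two
  have hY : 2 ≤ √2 * (D * X) := by nlinarith [mul_le_mul hD2 hX1 zero_le_one (by linarith)]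
  have h1 : √2 * J * (1 + (d + 1) / δ) ≤ 4 / 5 * (√2 * (D * X)) := by
    rw [hδD]
    calc √2 * J * (1 + (d + 1) * (D / 2)) ≤ √2 * J * ((d + 2) * (D / 2)) := by
          refine mul_le_mul_of_nonneg_left ?_ (by positivity)
          nlinarith
      _ = √2 * (D / 2) * ((d + 2) * J) := by ring
      _ ≤ √2 * (D / 2) * (8 / 5 * X) := mul_le_mul_of_nonneg_left hJ2 (by positivity)
      _ = _ := by ring
  -- With `Y = √2 D X`, this reduces to `1.376 Y ≤ 1.72 Y - 0.14`, true since `Y ≥ 2`. After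
  -- multiplication by `s = √(lmax/lmin) ≥ 1`, the `-1` becomes `-s ≤ -1`.
  have h2 : √2 * J * (1 + (d + 1) / δ) * (Real.exp 1 - 1) ≤
      Real.exp 1 / Real.pi * (1 + 2 * √2 * P) - 1 := by
    have h3 : √2 * J * (1 + (d + 1) / δ) * (Real.exp 1 - 1) ≤
        4 / 5 * (√2 * (D * X)) * (172 / 100) :=
      mul_le_mul h1 (by linarith) (by linarith) (by linarith)
    have h4 : (86 / 100) * (1 + 2 * (√2 * (D * X))) ≤
        Real.exp 1 / Real.pi * (1 + 2 * √2 * P) := by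
      refine mul_le_mul hq ?_ (by linarith) (by positivity)
      have := mul_le_mul_of_nonneg_left hDX (Real.sqrt_nonneg 2)
      linarith
    linarith
  have h5 := mul_le_mul_of_nonneg_left h2 (Real.sqrt_nonneg (lmax / lmin))
  rw [shellConst, decayLength, hr2, ← hs, ← hD, ← hP]
  rw [← hs] at h5
  linarith

end Constants

/-! ### Hole filling and iteration over shells. -/

section Decay

variable {d m : ℕ} {Ω : Set (EuclideanSpace ℝ (Fin d))}
  {a : EuclideanSpace ℝ (Fin d) → Matrix (Fin d) (Fin d) ℝ} {lmin lmax : ℝ}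
  {τ : Fin m → Set (EuclideanSpace ℝ (Fin d))} {H δ : ℝ}

local notation "E" => EuclideanSpace ℝ (Fin d)

theorem IsUniformlyElliptic.le (ha : IsUniformlyElliptic Ω a lmin lmax) (hd : 0 < d)
    (hΩ0 : volume Ω ≠ 0) : lmin ≤ lmax := by
  have : (ae (volume.restrict Ω)).NeBot := by
    rw [ae_neBot, Ne, Measure.restrict_eq_zero]
    exact hΩ0
  obtain ⟨x, h1, h2⟩ := (ha.lower.and ha.upper).exists
  have h3 := (h1 (EuclideanSpace.single ⟨0, hd⟩ 1)).trans (h2 (EuclideanSpace.single ⟨0, hd⟩ 1))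
  simpa using h3

open scoped Classical in
/-- The energy of all cells that are not contained in the ball `B(x, R)`. -/
def outerEnergy (a : E → Matrix (Fin d) (Fin d) ℝ) (τ : Fin m → Set E) (ψ : H10 Ω) (x : E)
    (R : ℝ) : ℝ :=
  ∑ j with ¬ τ j ⊆ Metric.ball x R, energyOn a (τ j) ψ

/-- A radial cutoff, vanishing in `B(x, R)` and equal to one outside `B(x, R + w)`. -/
def radialCutoff (x : E) (R w : ℝ) (y : E) : ℝ := max 0 (min 1 ((dist y x - R) / w))

theorem lipschitzWith_radialCutoff (x : E) (R : ℝ) {w : ℝ} (hw : 0 < w) :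
    LipschitzWith (Real.toNNReal w⁻¹) (radialCutoff x R w) := by
  have h : LipschitzWith (Real.toNNReal w⁻¹) fun y => (dist y x - R) / w := by
    refine LipschitzWith.of_dist_le_mul fun y z => ?_
    rw [Real.coe_toNNReal _ (inv_nonneg.2 hw.le), Real.dist_eq, ← sub_div, sub_sub_sub_cancel_right,
      abs_div, abs_of_pos hw, div_eq_inv_mul]
    exact mul_le_mul_of_nonneg_left (abs_dist_sub_le y z x) (inv_nonneg.2 hw.le)
  exact (h.const_min 1).const_max 0

/-- The cutoff rises over a width `w`. The additional `H` is one cell diameter: a cell not contained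
in `B(x, R+w+H)` lies entirely outside `B(x, R+w)`, where the cutoff is one. The condition `H ≤ R`
makes the cutoff vanish on the cell of `x`. -/
theorem outerEnergy_step (ha : IsUniformlyElliptic Ω a lmin lmax) (hΩo : IsOpen Ω)
    (hΩ : Bornology.IsBounded Ω) (hτ : IsCellPartition Ω τ H δ) (hH : 0 < H) (hδ : 0 < δ)
    {i : Fin m} {ψ : H10 Ω} (hψ : IsGamblet a (measurementFun τ) i ψ) {x : E} (hx : x ∈ τ i)
    {R w : ℝ} (hR : H ≤ R) (hw : 0 < w) :
    outerEnergy a τ ψ x (R + w + H) ≤ w⁻¹ * H * shellConst d lmin lmax δ *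
      (outerEnergy a τ ψ x R - outerEnergy a τ ψ x (R + w + H)) := by
  classical
  set O : Finset (Fin m) := Finset.univ.filter fun j => ¬ τ j ⊆ Metric.ball x (R + w + H) with hO
  set T : Finset (Fin m) := Finset.univ.filter fun j =>
    ¬ τ j ⊆ Metric.ball x R ∧ τ j ⊆ Metric.ball x (R + w + H) with hT
  have hOT : Disjoint O T := by
    rw [Finset.disjoint_left]
    intro j h1 h2
    simp only [hO, hT, Finset.mem_filter] at h1 h2
    exact h1.2 h2.2.2
  have hdist : ∀ j, ∀ y ∈ τ j, ∀ z ∈ τ j, dist y z ≤ H := fun j y hy z hz =>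
    (Metric.dist_le_diam_of_mem (hΩ.subset (hτ.subset j)) hy hz).trans (hτ.diam_le j)
  have hzero : ∀ y, dist y x ≤ R → radialCutoff x R w y = 0 := fun y hy => by
    refine max_eq_left ((min_le_right _ _).trans ?_)
    exact div_nonpos_of_nonpos_of_nonneg (by linarith) hw.le
  have hmean : ∀ j, j ≠ i → ∫ x in τ j, ψ.toFun x = 0 := fun j hj => by
    rw [← integral_measurementFun_mul hτ, hψ.1 j, if_neg hj.symm]
  have key := sum_energyOn_le ha hΩo hΩ hτ hH hδ
    (fun w hw => hψ.integral_matForm_eq_zero ha hΩ hτ w hw) hmean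
    (lipschitzWith_radialCutoff x R hw) (fun y => le_max_left _ _)
    (fun y => max_le zero_le_one (min_le_left _ _))
    (fun y hy => hzero y ((hdist i y hy x hx).trans hR)) hOT
    (fun j hj y hy => by
      simp only [hO, Finset.mem_filter, not_subset] at hj
      obtain ⟨-, z, hz, hz'⟩ := hj
      rw [Metric.mem_ball, not_lt] at hz'
      have h1 := hdist j z hz y hy
      have h2 := dist_triangle z y x
      have h3 : 1 ≤ (dist y x - R) / w := by rw [le_div_iff₀ hw]; linarith
      rw [radialCutoff, min_eq_left h3, max_eq_right zero_le_one])
    (fun j h1 h2 y hy => by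
      simp only [hO, hT, Finset.mem_filter, Finset.mem_univ, true_and, not_not, not_and] at h1 h2
      have h3 : τ j ⊆ Metric.ball x R := by
        by_contra h
        exact h2 h h1
      exact hzero y (le_of_lt (Metric.mem_ball.1 (h3 hy))))
  rw [Real.coe_toNNReal _ (inv_nonneg.2 hw.le)] at key
  have hOeq : outerEnergy a τ ψ x (R + w + H) = ∑ j ∈ O, energyOn a (τ j) ψ := by
    rw [outerEnergy, hO]
  have hsplit : outerEnergy a τ ψ x R = outerEnergy a τ ψ x (R + w + H) +
      ∑ j ∈ T, energyOn a (τ j) ψ := by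
    rw [hOeq, ← Finset.sum_union hOT, outerEnergy]
    congr 1
    ext j
    simp only [hO, hT, Finset.mem_filter, Finset.mem_union, Finset.mem_univ, true_and]
    have : τ j ⊆ Metric.ball x R → τ j ⊆ Metric.ball x (R + w + H) := fun h =>
      h.trans (Metric.ball_subset_ball (by linarith))
    tauto
  rw [hsplit, add_sub_cancel_left, hOeq]
  exact key

theorem outerEnergy_anti (ha : IsUniformlyElliptic Ω a lmin lmax)
    (hτ : IsCellPartition Ω τ H δ) (ψ : H10 Ω) (x : E) {R R' : ℝ} (h : R ≤ R') :
    outerEnergy a τ ψ x R' ≤ outerEnergy a τ ψ x R := by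
  classical
  refine Finset.sum_le_sum_of_subset_of_nonneg ?_ fun j _ _ => energyOn_nonneg ha (hτ.subset j) ψ
  intro j
  simp only [Finset.mem_filter, Finset.mem_univ, true_and]
  exact fun h1 h2 => h1 (h2.trans (Metric.ball_subset_ball h))

theorem outerEnergy_le (ha : IsUniformlyElliptic Ω a lmin lmax)
    (hτ : IsCellPartition Ω τ H δ) (ψ : H10 Ω) (x : E) (R : ℝ) :
    outerEnergy a τ ψ x R ≤ energyOn a Ω ψ := by
  classical
  rw [energyOn_eq Ω, hτ.setIntegral_eq_sum (ha.integrable ψ.memLp_grad ψ.memLp_grad)]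
  exact Finset.sum_le_sum_of_subset_of_nonneg (Finset.filter_subset _ _)
    fun j _ _ => energyOn_nonneg ha (hτ.subset j) ψ

theorem energyOn_mono (ha : IsUniformlyElliptic Ω a lmin lmax) (ψ : H10 Ω) {S T : Set E}
    (hST : S ⊆ T) (hT : T ⊆ Ω) : energyOn a S ψ ≤ energyOn a T ψ := by
  refine setIntegral_mono_set (IntegrableOn.mono_set (ha.integrable ψ.memLp_grad ψ.memLp_grad) hT)
    ?_ hST.eventuallyLE
  filter_upwards [ae_restrict_of_ae_restrict_of_subset hT ha.ae_nonneg] with x hx using hx _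

theorem energyOn_diff_ball_le (ha : IsUniformlyElliptic Ω a lmin lmax)
    (hτ : IsCellPartition Ω τ H δ) (ψ : H10 Ω) (x : E) (R : ℝ) :
    energyOn a (Ω ∩ (Metric.ball x R)ᶜ) ψ ≤ outerEnergy a τ ψ x R := by
  classical
  have hi := ha.integrable ψ.memLp_grad ψ.memLp_grad
  have hm : MeasurableSet (Metric.ball x R)ᶜ := measurableSet_ball.compl
  have h1 : energyOn a (Ω ∩ (Metric.ball x R)ᶜ) ψ =
      ∑ j, energyOn a (τ j ∩ (Metric.ball x R)ᶜ) ψ := by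
    simp only [energyOn_eq]
    rw [← setIntegral_indicator hm, hτ.setIntegral_eq_sum (hi.indicator hm)]
    exact Finset.sum_congr rfl fun j _ => setIntegral_indicator hm
  rw [h1, outerEnergy, Finset.sum_filter]
  refine Finset.sum_le_sum fun j _ => ?_
  split_ifs with h
  · rw [disjoint_iff_inter_eq_empty.1 (disjoint_compl_right_iff_subset.2 h)]
    simp [energyOn]
  · exact energyOn_mono ha ψ inter_subset_left (hτ.subset j)

/-- Each step uses a cutoff of width `(L-2)H` plus one cell diameter `H`, so the radius grows by
`(L-1)H` and the energy shrinks by a factor `e`. -/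
theorem outerEnergy_iterate (ha : IsUniformlyElliptic Ω a lmin lmax) (hd : 0 < d) (hΩo : IsOpen Ω)
    (hΩ : Bornology.IsBounded Ω) (hτ : IsCellPartition Ω τ H δ) (hH : 0 < H) (hδ0 : 0 < δ)
    (hδ1 : δ < 1) (hle : lmin ≤ lmax) {i : Fin m} {ψ : H10 Ω}
    (hψ : IsGamblet a (measurementFun τ) i ψ) {x : E} (hx : x ∈ τ i) (N : ℕ) :
    outerEnergy a τ ψ x (H + N * ((decayLength d lmin lmax δ - 1) * H)) ≤
      Real.exp (-N) * energyOn a Ω ψ := by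
  have hnum := shellConst_mul_le hd ha.lmin_pos hle hδ0 hδ1
  have he := Real.exp_one_gt_d9
  have hJ := halfPowIntegral_pos d
  have hlm := ha.lmin_pos
  have hlM := hlm.trans_le hle
  have hK : 0 < shellConst d lmin lmax δ := by rw [shellConst]; positivity
  set K := shellConst d lmin lmax δ
  set L := decayLength d lmin lmax δ with hL
  have hL2 : 0 < L - 2 := lt_of_lt_of_le (mul_pos hK (by linarith)) hnum
  induction N with
  | zero => simpa using outerEnergy_le ha hτ ψ x H
  | succ N ih =>
    set R := H + N * ((L - 1) * H) with hR
    have hR' : H + ((N + 1 : ℕ) : ℝ) * ((L - 1) * H) = R + (L - 2) * H + H := by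
      rw [hR]; push_cast; ring
    have hRH : H ≤ R := by
      have h0 : 0 ≤ (N : ℝ) * ((L - 1) * H) :=
        mul_nonneg N.cast_nonneg (mul_nonneg (by linarith) hH.le)
      linarith
    have hstep := outerEnergy_step ha hΩo hΩ hτ hH hδ0 hψ hx hRH (mul_pos hL2 hH)
    have hanti := outerEnergy_anti ha hτ ψ x (R := R) (R' := R + (L - 2) * H + H)
      (by nlinarith)
    rw [hR']
    set g := outerEnergy a τ ψ x R
    set g' := outerEnergy a τ ψ x (R + (L - 2) * H + H)
    have h1 : ((L - 2) * H)⁻¹ * H * K = K / (L - 2) := by field_simp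
    rw [h1, div_mul_eq_mul_div, le_div_iff₀ hL2] at hstep
    -- Hole filling: `L - 2` is replaced by the smaller `K(e - 1)`, and moving `-K g'` to the left
    -- turns `e - 1` into `e`.
    have h2 : g' * (K * (Real.exp 1 - 1)) ≤ K * (g - g') := by
      have hg0 : 0 ≤ g' := Finset.sum_nonneg fun j _ => energyOn_nonneg ha (hτ.subset j) ψ
      exact (mul_le_mul_of_nonneg_left hnum hg0).trans hstep
    have h3 : Real.exp 1 * g' ≤ g := by
      have : K * (Real.exp 1 * g') ≤ K * g := by linarith
      exact le_of_mul_le_mul_left this hK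
    have h4 : Real.exp (-((N + 1 : ℕ) : ℝ)) = Real.exp (-N) * (Real.exp 1)⁻¹ := by
      rw [← Real.exp_neg, ← Real.exp_add]
      congr 1
      push_cast
      ring
    rw [h4, mul_right_comm, ← div_eq_mul_inv, le_div_iff₀ (Real.exp_pos 1)]
    linarith

end Decay

end

theorem mainTheorem2 (d m : ℕ) (hd : 0 < d)
    (Ω : Set (EuclideanSpace ℝ (Fin d))) (hΩ_open : IsOpen Ω)
    (hΩ_bdd : Bornology.IsBounded Ω)
    (a : EuclideanSpace ℝ (Fin d) → Matrix (Fin d) (Fin d) ℝ) (lmin lmax : ℝ)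
    (ha : IsUniformlyElliptic Ω a lmin lmax)
    (H δ : ℝ) (hH : 0 < H) (hδ0 : 0 < δ) (hδ1 : δ < 1)
    (τ : Fin m → Set (EuclideanSpace ℝ (Fin d))) (hτ : IsCellPartition Ω τ H δ)
    (i : Fin m) (ψ : H10 Ω) (hψ : IsGamblet a (measurementFun τ) i ψ)
    (x : EuclideanSpace ℝ (Fin d)) (hx : x ∈ τ i) (r : ℝ) (hr : 0 ≤ r) :
    energyOn a (Ω ∩ (Metric.ball x r)ᶜ) ψ ≤
      Real.exp (1 - r / (decayLength d lmin lmax δ * H)) * energyOn a Ω ψ := by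
  have hΩ0 : volume Ω ≠ 0 := fun h => by
    have := hτ.measureReal_pos hΩ_bdd hH hδ0 i
    rw [measureReal_def, measure_mono_null (hτ.subset i) h] at this
    simp at this
  have hle := ha.le hd hΩ0
  have hE0 := energyOn_nonneg ha le_rfl ψ
  have hL1 : 1 ≤ decayLength d lmin lmax δ := by
    rw [decayLength]
    have := Real.pi_pos
    have : 0 ≤ Real.exp 1 / Real.pi * √(lmax / lmin) *
      (1 + (2 : ℝ) ^ (3 / 2 : ℝ) * (2 / δ) ^ (1 + (d : ℝ) / 2)) := by positivity
    linarith
  set L := decayLength d lmin lmax δ with hL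
  have hLH : 0 < L * H := mul_pos (by linarith) hH
  -- Rounding down loses less than one step, which accounts for the prefactor `e`.
  set N := ⌊r / (L * H)⌋₊ with hN
  have hNr : (N : ℝ) ≤ r / (L * H) := Nat.floor_le (by positivity)
  have hrN : r / (L * H) < N + 1 := Nat.lt_floor_add_one _
  refine le_trans ?_ (mul_le_mul_of_nonneg_right
    (Real.exp_le_exp.2 (by linarith : -(N : ℝ) ≤ 1 - r / (L * H))) hE0)
  -- For `N = 0` monotonicity of the energy suffices. For `N ≥ 1` the starting radius `H` is paid
  -- for by using `L` instead of `L - 1`: `H + N(L-1)H ≤ NLH ≤ r`.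
  rcases Nat.eq_zero_or_pos N with h0 | h0
  · rw [h0]
    simpa using energyOn_mono ha ψ inter_subset_left le_rfl
  · refine (energyOn_diff_ball_le ha hτ ψ x r).trans (le_trans ?_
      (outerEnergy_iterate ha hd hΩ_open hΩ_bdd hτ hH hδ0 hδ1 hle hψ hx N))
    refine outerEnergy_anti ha hτ ψ x ?_
    rw [le_div_iff₀ hLH] at hNr
    have h1 : (1 : ℝ) ≤ N := by exact_mod_cast h0
    nlinarith
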